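/- **Theorem (Strong ACV-CV selection error).** *Setting.* Let $n\ge 1$, let $z_1,\dots,z_n\in\mathcal X$ be datapoints, and let the losses $\ell(z_i,\cdot):\mathbb R^d\to\mathbb R$ and the regularizer $\pi:\mathbb R^d\to\mathbb R$ be everywhere twice differentiable. Put $\ell(\mathbb P_n,\beta)=\frac1n\sum_{j}\ell(z_j,\beta)$, $\ell(\mathbb P_{n,-i},\beta)=\frac1n\sum_{j\ne i}\ell(z_j,\beta)$ and $m(\mu,\beta,\lambda)=\ell(\mu,\beta)+\lambda\pi(\beta)$. Let $\Lambda\subseteq[0,\infty]$ with $0\in\Lambda$. For $\lambda\in\Lambda$ let $\hat\beta(\lambda)$ and $\hat\beta_{-i}(\lambda)$ be minimizers of $m(\mathbb P_n,\cdot,\lambda)$ and $m(\mathbb P_{n,-i},\cdot,\lambda)$ (of $\pi$ if $\lambda=\infty$), and let $$\tilde\beta_{-i}(\lambda)=\hat\beta(\lambda)+\nabla^2_\beta m(\mathbb P_{n,-i},\hat\beta(\lambda),\lambda)^{-1}\tfrac1n\nabla_\beta\ell(z_i,\hat\beta(\lambda))\quad(\lambda<\infty),\qquad \tilde\beta_{-i}(\infty)=\hat\beta(\infty),$$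 $$\mathrm{CV}(\lambda)=\tfrac1n\sum_i\ell(z_i,\hat\beta_{-i}(\lambda)),\qquad \mathrm{ACV}(\lambda)=\tfrac1n\sum_i\ell(z_i,\tilde\beta_{-i}(\lambda)).$$ A function $\varphi$ has $\nu$ gradient growth if its subdifferential $\partial\varphi$ is everywhere nonempty and $\nu(\|x-y\|_2)\le\langle y-x,u-v\rangle$ for all $x,y\in\mathbb R^d$, $u\in\partial\varphi(y)$, $v\in\partial\varphi(x)$. $\mathrm{Lip}(f)=\sup_{x\ne y}\|f(x)-f(y)\|/\|x-y\|_2\in[0,\infty]$ (operator norm for matrix-valued $f$). *Assumptions.* There are $c_\ell,c_\pi,c_m>0$, $\lambda_\pi\in[0,\infty)$ and $C_{\ell,2},C_{\pi,2},C_{\ell,3},C_{\pi,3}\in[0,\infty)$ with the following properties. (A condition at $\lambda=\infty$, or at $\lambda'=\infty$ in the second part of 1, is read after dividing it by that parameter and letting it tend to $\infty$: $m(\mu,\cdot,\infty)$ is replaced by $\pi$, a bound $a+\infty\cdot b$ by $b$, and $c_m$ by $0$.) 1. (Curvature) For all $i$ and all $\lambda,\lambda'\in\Lambda$, $m(\mathbb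 P_{n,-i},\cdot,\lambda)$ has $\nu(r)=c_mr^2$ gradient growth and $\nabla^2_\beta m(\mathbb P_{n,-i},\hat\beta(\lambda),\lambda')\succeq(c_\ell+\lambda'c_\pi\mathbf 1[\lambda\ge\lambda_\pi])\,\mathrm I_d$. 2. (Bounded moments) $B_{s,r}=\sup_{\lambda\in\Lambda}\frac1n\sum_i\mathrm{Lip}(\nabla_\beta\ell(z_i,\cdot))^s\|\nabla_\beta\ell(z_i,\hat\beta(\lambda))\|_2^r<\infty$ for $(s,r)\in\{(0,3),(1,1),(1,2),(1,3),(1,4)\}$ (with $\infty^0=1$ and $\infty\cdot0=0$). 3. (Lipschitz Hessian) $\mathrm{Lip}(\nabla^2_\beta m(\mathbb P_{n,-i},\cdot,\lambda))\le C_{\ell,3}+\lambda C_{\pi,3}$ for all $\lambda\in\Lambda$ and all $i$. 4. (Bounded Hessian) $\nabla^2_\beta m(\mathbb P_n,\beta,\lambda)\preceq(C_{\ell,2}+\lambda C_{\pi,2})\,\mathrm I_d$ for all $\lambda\in\Lambda$ and $\beta\in\mathbb R^d$, and $\nabla^2\pi(\hat\beta(\lambda))\preceq C_{\pi,2}\,\mathrm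 I_d$ for all $\lambda\in\Lambda$ (the latter follows from the former if $\Lambda$ is unbounded or contains $\infty$). 5. (Identifiability) $\|\nabla\pi(\hat\beta(0))\|_2>0$. *Constants.* Let $\kappa_p=\sup_{t\in[0,\infty)}\dfrac{C_{\ell,p+1}+tC_{\pi,p+1}}{p!\,(c_\ell+tc_\pi\mathbf 1[t\ge\lambda_\pi])}$ for $p\in\{1,2\}$, $$A=\frac{B_{1,1}+B_{0,2}\kappa_2}{c_\ell/2}+\frac{B_{0,2}C_{\pi,2}\kappa_1^2}{\|\nabla\pi(\hat\beta(0))\|_2\,c_m},\qquad A'=\frac{B_{1,2}}{c_m^2},\qquad A''=2\Big(\kappa_2\frac{B_{0,3}}{c_m^2}+\frac{\kappa_2}{n}\frac{B_{1,3}}{c_m^3}+\frac{\kappa_2^2}{n^2}\frac{B_{1,4}}{2c_m^4}\Big).$$ *Conclusion.* For all $\lambda',\lambda\in\Lambda$ with $\lambda'<\lambda$, $$\Big|\,\|\hat\beta(\lambda)-\hat\beta(\lambda')\|_2-\frac1n\frac A{c_m}\Big|^2\le\frac{A^2+2c_mA'}{n^2c_m^2}+\frac{2(\mathrm{ACV}(\lambda)-\mathrm{ACV}(\lambda'))}{c_m},$$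 and for all $\lambda_{\mathrm{ACV}}\in\arg\min_{\lambda\in\Lambda}\mathrm{ACV}(\lambda)$ and $\lambda_{\mathrm{CV}}\in\arg\min_{\lambda\in\Lambda}\mathrm{CV}(\lambda)$, $$\Big|\,\|\hat\beta(\lambda_{\mathrm{ACV}})-\hat\beta(\lambda_{\mathrm{CV}})\|_2-\frac1n\frac A{c_m}\Big|^2\le\frac{A^2+2c_mA'+2c_mA''}{n^2c_m^2}.$$ In particular the estimators selected by ACV and by CV are within $O(1/n)$ of each other: $\|\hat\beta(\lambda_{\mathrm{ACV}})-\hat\beta(\lambda_{\mathrm{CV}})\|_2\le\frac1n\cdot\frac{A+\sqrt{A^2+2c_mA'+2c_mA''}}{c_m}$. -/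

import Mathlib

open scoped ENNReal NNReal Gradient

noncomputable section

namespace ApproxCV

/-! ### General notions on `ℝ^d` -/

/-- `ℝ^d` with the Euclidean norm. -/
abbrev Vec (d : ℕ) : Type := EuclideanSpace ℝ (Fin d)

/-- The Hessian of `f` at `x`, as a linear operator: the derivative of the gradient. -/
def hess {d : ℕ} (f : Vec d → ℝ) (x : Vec d) : Vec d →L[ℝ] Vec d :=
  fderiv ℝ (fun y => ∇ f y) x

/-- Everywhere twice differentiable. -/
def TwiceDifferentiable {d : ℕ} (f : Vec d → ℝ) : Prop :=
  Differentiable ℝ f ∧ Differentiable ℝ (fun y => ∇ f y)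

/-- The subdifferential (of convex analysis) of `φ` at `y`. -/
def subdifferential {d : ℕ} (φ : Vec d → ℝ) (y : Vec d) : Set (Vec d) :=
  {u | ∀ x, φ y + inner ℝ u (x - y) ≤ φ x}

/-- `φ` has `ν` gradient growth: it is subdifferentiable and
`ν(‖x - y‖) ≤ ⟨y - x, u - v⟩` for all `x, y` and all `u ∈ ∂φ(y)`, `v ∈ ∂φ(x)`. -/
def GradientGrowth {d : ℕ} (ν : ℝ → ℝ) (φ : Vec d → ℝ) : Prop :=
  (∀ y, (subdifferential φ y).Nonempty) ∧
    ∀ x y u v, u ∈ subdifferential φ y → v ∈ subdifferential φ x →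
      ν ‖x - y‖ ≤ inner ℝ (y - x) (u - v)

/-- The best Lipschitz constant `sup_{x ≠ y} ‖f x - f y‖ / ‖x - y‖`, possibly `∞`. For operator
valued `f` the norm is the operator norm. -/
def lipConst {X Y : Type*} [PseudoEMetricSpace X] [PseudoEMetricSpace Y] (f : X → Y) : ℝ≥0∞ :=
  ⨆ (x : X) (y : X) (_ : x ≠ y), edist (f x) (f y) / edist x y

/-- `a + lam * b` for finite `lam`. At `lam = ∞` quantities of this form are normalized by
dividing by `lam` and letting `lam → ∞`, which leaves `b`. -/
def penalized (lam : ℝ≥0∞) (a b : ℝ) : ℝ :=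
  if lam = ∞ then b else a + lam.toReal * b

/-! ### Regularized empirical risk minimization and (approximate) cross-validation -/

/-- A loss function, a regularizer and a training set of `n` datapoints. -/
structure Problem (d n : ℕ) (Z : Type*) where
  loss : Z → Vec d → ℝ
  reg : Vec d → ℝ
  data : Fin n → Z

namespace Problem

variable {d n : ℕ} {Z : Type*} (P : Problem d n Z)

/-- `ℓ(z_i, ·)`. -/
def lossAt (i : Fin n) : Vec d → ℝ := P.loss (P.data i)

/-- The loss under the empirical distribution `(1/n) ∑ i, δ_{z_i}`. -/
def empLoss (β : Vec d) : ℝ := (1 / (n : ℝ)) * ∑ j, P.lossAt j β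

/-- The loss under the leave-one-out measure `(1/n) ∑ j ≠ i, δ_{z_j}`. -/
def looLoss (i : Fin n) (β : Vec d) : ℝ := (1 / (n : ℝ)) * ∑ j with j ≠ i, P.lossAt j β

/-- The full-data objective `ℓ(ℙ_n, β) + lam * π(β)`; it is `π(β)` for `lam = ∞`. -/
def empObj (lam : ℝ≥0∞) (β : Vec d) : ℝ := penalized lam (P.empLoss β) (P.reg β)

/-- The leave-one-out objective `ℓ(ℙ_{n,-i}, β) + lam * π(β)`; it is `π(β)` for `lam = ∞`. -/
def looObj (i : Fin n) (lam : ℝ≥0∞) (β : Vec d) : ℝ :=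
  penalized lam (P.looLoss i β) (P.reg β)

/-- `est lam` is a minimizer of the full-data objective, for each `lam ∈ Λ`. -/
def IsEstimator (Λ : Set ℝ≥0∞) (est : ℝ≥0∞ → Vec d) : Prop :=
  ∀ lam ∈ Λ, IsMinOn (P.empObj lam) Set.univ (est lam)

/-- `cvest i lam` is a minimizer of the `i`-th leave-one-out objective, for each `lam ∈ Λ`. -/
def IsCVEstimator (Λ : Set ℝ≥0∞) (cvest : Fin n → ℝ≥0∞ → Vec d) : Prop :=
  ∀ i, ∀ lam ∈ Λ, IsMinOn (P.looObj i lam) Set.univ (cvest i lam)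

/-- The leave-one-out cross-validation error. -/
def CV (cvest : Fin n → ℝ≥0∞ → Vec d) (lam : ℝ≥0∞) : ℝ :=
  (1 / (n : ℝ)) * ∑ i, P.lossAt i (cvest i lam)

/-- The approximate leave-one-out estimator
`est lam + (∇² m(ℙ_{n,-i}, est lam, lam))⁻¹ (∇ ℓ(z_i, est lam)) / n`. For `lam = ∞` the inverse
Hessian of `ℓ + lam * π` vanishes in the limit, so the Newton step is zero. -/
def acvest (est : ℝ≥0∞ → Vec d) (i : Fin n) (lam : ℝ≥0∞) : Vec d :=
  if lam = ∞ then est ∞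
  else est lam + (hess (P.looObj i lam) (est lam)).inverse
    ((1 / (n : ℝ)) • ∇ (P.lossAt i) (est lam))

/-- The approximate cross-validation error. -/
def ACV (est : ℝ≥0∞ → Vec d) (lam : ℝ≥0∞) : ℝ :=
  (1 / (n : ℝ)) * ∑ i, P.lossAt i (P.acvest est i lam)

/-- The moment
`B_{s,r} = sup_{lam ∈ Λ} (1/n) ∑ i, Lip(∇ ℓ(z_i, ·))^s ‖∇ ℓ(z_i, est lam)‖^r` in `[0, ∞]`. -/
def moment (Λ : Set ℝ≥0∞) (est : ℝ≥0∞ → Vec d) (s r : ℕ) : ℝ≥0∞ :=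
  ⨆ lam ∈ Λ, (n : ℝ≥0∞)⁻¹ *
    ∑ i, lipConst (fun β => ∇ (P.lossAt i) β) ^ s * ‖∇ (P.lossAt i) (est lam)‖ₑ ^ r

/-- Curvature of the objective: for all `i` and all `lam, lam' ∈ Λ`, the leave-one-out objective
has `cobj * r ^ 2` gradient growth and
`∇² m(ℙ_{n,-i}, est lam, lam') ≽ (closs + lam' * creg * 1[lam ≥ lamreg]) I`. -/
def Curvature (Λ : Set ℝ≥0∞) (est : ℝ≥0∞ → Vec d) (closs creg cobj : ℝ) (lamreg : ℝ≥0) :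
    Prop :=
  0 < closs ∧ 0 < creg ∧ 0 < cobj ∧
    (∀ i, ∀ lam ∈ Λ, GradientGrowth (fun r => penalized lam cobj 0 * r ^ 2) (P.looObj i lam)) ∧
    (∀ i, ∀ lam ∈ Λ, ∀ lam' ∈ Λ,
      penalized lam' closs (if (lamreg : ℝ≥0∞) ≤ lam then creg else 0) •
        ContinuousLinearMap.id ℝ (Vec d) ≤ hess (P.looObj i lam') (est lam))

/-- Lipschitz Hessian of the objective:
`Lip(∇² m(ℙ_{n,-i}, ·, lam)) ≤ Closs3 + lam * Creg3` for all `i` and all `lam ∈ Λ`. -/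
def LipschitzHessian (Λ : Set ℝ≥0∞) (Closs3 Creg3 : ℝ) : Prop :=
  0 ≤ Closs3 ∧ 0 ≤ Creg3 ∧
    ∀ i, ∀ lam ∈ Λ, lipConst (hess (P.looObj i lam)) ≤
      ENNReal.ofReal (penalized lam Closs3 Creg3)

/-- Bounded Hessian of the objective:
`∇² m(ℙ_n, β, lam) ≼ (Closs2 + lam * Creg2) I` for all `lam ∈ Λ` and all `β`, where `Creg2` is
the contribution of the regularizer: `∇² π(est lam) ≼ Creg2 I` for all `lam ∈ Λ`. (The last
condition follows from the first one when `Λ` is unbounded or contains `∞`.) -/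
def BoundedHessian (Λ : Set ℝ≥0∞) (est : ℝ≥0∞ → Vec d) (Closs2 Creg2 : ℝ) : Prop :=
  0 ≤ Closs2 ∧ 0 ≤ Creg2 ∧
    (∀ lam ∈ Λ, ∀ β, hess (P.empObj lam) β ≤
      penalized lam Closs2 Creg2 • ContinuousLinearMap.id ℝ (Vec d)) ∧
    (∀ lam ∈ Λ, hess P.reg (est lam) ≤ Creg2 • ContinuousLinearMap.id ℝ (Vec d))

end Problem

/-- `κ_p = sup_{t ≥ 0} (Closs + t * Creg) / (p! (closs + t * creg * 1[t ≥ lamreg]))`, where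
`Closs, Creg` are the constants for the derivative of order `p + 1`. -/
def kappa (p : ℕ) (Closs Creg closs creg : ℝ) (lamreg : ℝ≥0) : ℝ :=
  ⨆ t : ℝ≥0, (Closs + t * Creg) /
    ((p.factorial : ℝ) * (closs + t * (if lamreg ≤ t then creg else 0)))

end ApproxCV

end

/-! Write `β(λ)` for `est lam`, `Δ = ‖β(λ) - β(λ')‖` with `λ' < λ`, `g_i = ∇ℓ(z_i, β(λ))`, and
`Q(λ)` for the average over `i` of `⟨g_i, H_i⁻¹ g_i⟩`, where `H_i` is the leave-one-out Hessian at
`β(λ)`.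

The training loss grows quadratically along the path. Minimality of `β(λ)` at level `λ` and of
`β(λ')` at level `λ'` forces `π(β(λ)) ≤ π(β(λ'))`, and strong convexity at level `λ'` then leaves a
loss gap of at least `c_m Δ² / 2` (`empLoss_sub_ge`). A Taylor expansion of each loss at `β(λ)`
shows that ACV is the training loss plus `Q(λ) / n`, up to `A' / (2n²)` (`abs_ACV_sub_le`).

The decisive point is that the correction varies only linearly: `Q(λ') - Q(λ) ≤ A Δ`
(`avg_newtonQuad_sub_le`). The change splits into moving the Hessian's base point (Lipschitz
Hessian), moving the gradients (Lipschitz gradients), and moving the regularization level. The last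
is controlled because `λ - λ'` is itself bounded by a multiple of `Δ` (`sub_le_mul_norm`), which
rests on identifiability at `0`. Hence `c_m Δ² / 2 ≤ A Δ / n + A' / n² + ACV(λ) - ACV(λ')`, and
completing the square gives the first bound.

For the selected levels, a Newton step misses the leave-one-out minimizer by `O(1/n²)`
(`norm_acvest_sub_le`), so `|ACV - CV| ≤ A'' / (2n²)` uniformly. The minimizer of CV is therefore
within `A'' / n²` of minimizing ACV. -/

namespace ApproxCV

/-! ### Calculus of gradients and Hessians -/

variable {d : ℕ}

/-- `G` is `c`-strongly monotone. -/
def StrongMono (c : ℝ) (G : Vec d → Vec d) : Prop :=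
  ∀ x y, c * ‖x - y‖ ^ 2 ≤ inner ℝ (x - y) (G x - G y)

theorem gradient_eq_of_forall_inner {f : Vec d → ℝ} {x g : Vec d}
    (h : ∀ v, fderiv ℝ f x v = inner ℝ g v) : ∇ f x = g :=
  ext_inner_right ℝ fun v => by rw [inner_gradient_left, h]

theorem gradient_add_fun {f g : Vec d → ℝ} {x : Vec d} (hf : DifferentiableAt ℝ f x)
    (hg : DifferentiableAt ℝ g x) : ∇ (fun y => f y + g y) x = ∇ f x + ∇ g x :=
  gradient_eq_of_forall_inner fun v => by
    rw [fderiv_fun_add hf hg, inner_add_left, inner_gradient_left, inner_gradient_left]; rfl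

theorem gradient_const_mul_fun {f : Vec d → ℝ} {x : Vec d} (hf : DifferentiableAt ℝ f x) (c : ℝ) :
    ∇ (fun y => c * f y) x = c • ∇ f x :=
  gradient_eq_of_forall_inner fun v => by
    rw [fderiv_const_mul hf, real_inner_smul_left, inner_gradient_left]; rfl

theorem gradient_sum_fun {ι : Type*} {s : Finset ι} {f : ι → Vec d → ℝ} {x : Vec d}
    (hf : ∀ i ∈ s, DifferentiableAt ℝ (f i) x) :
    ∇ (fun y => ∑ i ∈ s, f i y) x = ∑ i ∈ s, ∇ (f i) x :=
  gradient_eq_of_forall_inner fun v => by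
    rw [fderiv_fun_sum hf, sum_inner, sum_apply]
    exact Finset.sum_congr rfl fun i _ => inner_gradient_left.symm

theorem eq_gradient_of_mem_subdifferential {f : Vec d → ℝ} {y u : Vec d}
    (hf : DifferentiableAt ℝ f y) (hu : u ∈ subdifferential f y) : u = ∇ f y := by
  symm
  refine gradient_eq_of_forall_inner fun v => ?_
  have hd : HasFDerivAt (fun x => f x - inner ℝ u (x - y))
      (fderiv ℝ f y - innerSL ℝ u) y := by
    refine hf.hasFDerivAt.sub ?_
    simpa [inner_sub_right] using ((innerSL ℝ u).hasFDerivAt (x := y)).sub_const (inner ℝ u y)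
  have hmin : IsLocalMin (fun x => f x - inner ℝ u (x - y)) y :=
    Filter.Eventually.of_forall fun x => by
      have := hu x
      simp only [sub_self, inner_zero_right, sub_zero]
      linarith
  have h0 := congrArg (fun T : Vec d →L[ℝ] ℝ => T v) (hmin.hasFDerivAt_eq_zero hd)
  simpa [sub_eq_zero] using h0

theorem GradientGrowth.gradient_mem {ν : ℝ → ℝ} {f : Vec d → ℝ} (h : GradientGrowth ν f)
    (hf : Differentiable ℝ f) (y : Vec d) : ∇ f y ∈ subdifferential f y := by
  obtain ⟨u, hu⟩ := h.1 y
  rwa [← eq_gradient_of_mem_subdifferential (hf y) hu]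

theorem GradientGrowth.strongMono {c : ℝ} {f : Vec d → ℝ}
    (h : GradientGrowth (fun r => c * r ^ 2) f) (hf : Differentiable ℝ f) :
    StrongMono c (fun y => ∇ f y) := fun x y => by
  have := h.2 y x _ _ (h.gradient_mem hf x) (h.gradient_mem hf y)
  rwa [norm_sub_rev] at this

theorem hasDerivAt_comp_segment {F : Type*} [NormedAddCommGroup F] [NormedSpace ℝ F]
    {f : Vec d → F} {x v : Vec d} {t : ℝ} (hf : DifferentiableAt ℝ f (x + t • v)) :
    HasDerivAt (fun s : ℝ => f (x + s • v)) (fderiv ℝ f (x + t • v) v) t := by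
  have h1 : HasDerivAt (fun s : ℝ => x + s • v) v t := by
    simpa using ((hasDerivAt_id t).smul_const v).const_add x
  exact hf.hasFDerivAt.comp_hasDerivAt t h1

/-- Strong monotonicity makes `s ↦ ⟨∇f(x + s v), v⟩ - s c ‖v‖²` nondecreasing, so its derivative at
`0` is nonnegative. -/
theorem StrongMono.le_hess {c : ℝ} {f : Vec d → ℝ} (h : StrongMono c (fun y => ∇ f y))
    {x : Vec d} (hf : DifferentiableAt ℝ (fun y => ∇ f y) x) (v : Vec d) :
    c * ‖v‖ ^ 2 ≤ inner ℝ (hess f x v) v := by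
  have hd : HasDerivAt (fun s : ℝ => ∇ f (x + s • v)) (hess f x v) 0 := by
    have := hasDerivAt_comp_segment (f := fun y => ∇ f y) (x := x) (v := v) (t := 0)
      (by simpa using hf)
    simpa [hess] using this
  have hd2 : HasDerivAt (fun s : ℝ => inner ℝ (∇ f (x + s • v)) v - s * (c * ‖v‖ ^ 2))
      (inner ℝ (hess f x v) v - c * ‖v‖ ^ 2) 0 := by
    have h1 := hd.inner ℝ (hasDerivAt_const (0 : ℝ) v)
    have h2 := (hasDerivAt_id (0 : ℝ)).mul_const (c * ‖v‖ ^ 2)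
    simpa using h1.fun_sub h2
  have hm : Monotone (fun s : ℝ => inner ℝ (∇ f (x + s • v)) v - s * (c * ‖v‖ ^ 2)) := by
    intro s t hst
    rcases hst.eq_or_lt with rfl | hlt
    · rfl
    have := h (x + t • v) (x + s • v)
    have e : x + t • v - (x + s • v) = (t - s) • v := by rw [sub_smul]; abel
    rw [e, norm_smul, mul_pow, Real.norm_eq_abs, sq_abs, real_inner_smul_left, inner_sub_right,
      real_inner_comm, real_inner_comm (∇ f (x + s • v))] at this
    have h3 : c * ((t - s) * ‖v‖ ^ 2) ≤
        inner ℝ (∇ f (x + t • v)) v - inner ℝ (∇ f (x + s • v)) v := by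
      refine le_of_mul_le_mul_left ?_ (sub_pos.2 hlt)
      linarith
    simp only
    linarith
  have := Monotone.deriv_nonneg hm (x := 0)
  rw [hd2.deriv] at this
  linarith

theorem StrongMono.add_quadratic_le {c : ℝ} {f : Vec d → ℝ} (h : StrongMono c (fun y => ∇ f y))
    (hf : Differentiable ℝ f) (x y : Vec d) :
    f y + inner ℝ (∇ f y) (x - y) + c / 2 * ‖x - y‖ ^ 2 ≤ f x := by
  set v := x - y with hv
  have hd : ∀ t : ℝ, HasDerivAt
      (fun s : ℝ => f (y + s • v) - s * inner ℝ (∇ f y) v - s ^ 2 * (c / 2 * ‖v‖ ^ 2))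
      (inner ℝ (∇ f (y + t • v)) v - inner ℝ (∇ f y) v - 2 * t * (c / 2 * ‖v‖ ^ 2)) t := by
    intro t
    have h1 := hasDerivAt_comp_segment (v := v) (hf (y + t • v))
    rw [← inner_gradient_left] at h1
    have h2 := (hasDerivAt_id t).mul_const (inner ℝ (∇ f y) v)
    have h3 := ((hasDerivAt_id t).pow 2).mul_const (c / 2 * ‖v‖ ^ 2)
    simpa using (h1.fun_sub h2).fun_sub h3
  have hm := monotoneOn_of_deriv_nonneg (convex_Icc (0 : ℝ) 1)
    (fun t _ => (hd t).continuousAt.continuousWithinAt)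
    (fun t _ => (hd t).differentiableAt.differentiableWithinAt) (fun t ht => by
      rw [interior_Icc] at ht
      rw [(hd t).deriv]
      have := h (y + t • v) y
      rw [add_sub_cancel_left, norm_smul, mul_pow, Real.norm_eq_abs, sq_abs, real_inner_smul_left,
        inner_sub_right, real_inner_comm, real_inner_comm (∇ f y)] at this
      have h3 : c * (t * ‖v‖ ^ 2) ≤ inner ℝ (∇ f (y + t • v)) v - inner ℝ (∇ f y) v :=
        le_of_mul_le_mul_left (by linarith) ht.1
      linarith)
  have := hm (Set.left_mem_Icc.2 zero_le_one) (Set.right_mem_Icc.2 zero_le_one) zero_le_one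
  simp only [zero_smul, add_zero, one_smul, hv, add_sub_cancel] at this
  linarith

theorem gradient_eq_zero_of_isMinOn {f : Vec d → ℝ} {x : Vec d} (h : IsMinOn f Set.univ x) :
    ∇ f x = 0 := by
  have : fderiv ℝ f x = 0 := (h.isLocalMin Filter.univ_mem).fderiv_eq_zero
  simp [gradient, this]

theorem StrongMono.mul_norm_le {c : ℝ} {G : Vec d → Vec d} (h : StrongMono c G) (x y : Vec d) :
    c * ‖x - y‖ ≤ ‖G x - G y‖ := by
  rcases eq_or_ne x y with rfl | hne
  · simp
  have h1 := (h x y).trans (real_inner_le_norm _ _)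
  have h2 : 0 < ‖x - y‖ := norm_pos_iff.2 (sub_ne_zero.2 hne)
  exact le_of_mul_le_mul_left (by linarith) h2

/-- The Loewner order includes symmetry of the difference, so `T` is symmetric and its norm is the
supremum of its absolute Rayleigh quotients. No continuity of second derivatives is needed. -/
theorem norm_le_of_loewner {T : Vec d →L[ℝ] Vec d} {L : ℝ}
    (h0 : ∀ v, 0 ≤ inner ℝ (T v) v) (hL : T ≤ L • ContinuousLinearMap.id ℝ (Vec d)) (hL0 : 0 ≤ L) :
    ‖T‖ ≤ L := by
  have hp := (ContinuousLinearMap.le_def _ _).1 hL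
  have hs : T.IsSymmetric := by
    intro x y
    have := hp.isSymmetric x y
    simp only [ContinuousLinearMap.coe_coe, sub_apply,
      smul_apply, ContinuousLinearMap.id_apply, inner_sub_left,
      inner_sub_right, real_inner_smul_left, real_inner_smul_right] at this ⊢
    linarith
  rw [ContinuousLinearMap.norm_eq_iSup_rayleighQuotient T hs]
  refine Real.iSup_le (fun x => ?_) hL0
  have h1 := hp.inner_nonneg_left x
  simp only [sub_apply, smul_apply,
    ContinuousLinearMap.id_apply, inner_sub_left, real_inner_smul_left,
    real_inner_self_eq_norm_sq] at h1
  have h2 : T.reApplyInnerSelf x = inner ℝ (T x) x := rfl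
  rw [ContinuousLinearMap.rayleighQuotient, h2, abs_of_nonneg (div_nonneg (h0 x) (sq_nonneg _))]
  exact div_le_of_le_mul₀ (sq_nonneg _) hL0 (by linarith)

theorem norm_gradient_sub_le {f : Vec d → ℝ} {L : ℝ} (hL0 : 0 ≤ L)
    (hf : Differentiable ℝ (fun y => ∇ f y)) (hm : StrongMono 0 (fun y => ∇ f y))
    (hL : ∀ y, hess f y ≤ L • ContinuousLinearMap.id ℝ (Vec d)) (x y : Vec d) :
    ‖∇ f x - ∇ f y‖ ≤ L * ‖x - y‖ :=
  convex_univ.norm_image_sub_le_of_norm_fderiv_le (𝕜 := ℝ) (fun z _ => hf z)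
    (fun z _ => norm_le_of_loewner (fun v => (zero_mul _).symm.le.trans (hm.le_hess (hf z) v)) (hL z) hL0)
    (Set.mem_univ y) (Set.mem_univ x)

theorem norm_sub_sub_fderiv_le {F : Type*} [NormedAddCommGroup F] [NormedSpace ℝ F]
    {f : Vec d → F} {L : ℝ} (hf : Differentiable ℝ f) (x y : Vec d)
    (hL : ∀ z, ‖fderiv ℝ f z - fderiv ℝ f x‖ ≤ L * ‖z - x‖) :
    ‖f y - f x - fderiv ℝ f x (y - x)‖ ≤ L / 2 * ‖y - x‖ ^ 2 := by
  set v := y - x with hv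
  have hd : ∀ t : ℝ, HasDerivAt (fun s : ℝ => f (x + s • v) - f x - s • fderiv ℝ f x v)
      (fderiv ℝ f (x + t • v) v - fderiv ℝ f x v) t := by
    intro t
    have h1 := (hasDerivAt_comp_segment (v := v) (hf (x + t • v))).sub_const (f x)
    have h2 := (hasDerivAt_id t).smul_const (fderiv ℝ f x v)
    simpa using h1.fun_sub h2
  -- The derivative need not be integrable, so the remainder is compared with this boundary function
  -- instead of being integrated.
  have hB : ∀ t : ℝ, HasDerivAt (fun s : ℝ => L / 2 * ‖v‖ ^ 2 * s ^ 2) (L * t * ‖v‖ ^ 2) t := by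
    intro t
    exact ((hasDerivAt_pow 2 t).const_mul (L / 2 * ‖v‖ ^ 2)).congr_deriv (by push_cast; ring)
  have key := image_norm_le_of_norm_deriv_right_le_deriv_boundary (a := 0) (b := 1)
    (fun t _ => (hd t).continuousAt.continuousWithinAt)
    (fun t _ => (hd t).hasDerivWithinAt) (by simp) hB (fun t ht => by
      rw [← sub_apply]
      refine (ContinuousLinearMap.le_opNorm _ _).trans ?_
      have h1 := hL (x + t • v)
      rw [add_sub_cancel_left, norm_smul, Real.norm_eq_abs, abs_of_nonneg ht.1] at h1
      nlinarith [norm_nonneg v]) (Set.right_mem_Icc.2 zero_le_one)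
  simpa [hv] using key

theorem lipConst_le_iff {X : Type*} {Y : Type*} [NormedAddCommGroup X] [NormedAddCommGroup Y]
    {f : X → Y} {L : ℝ} (h : lipConst f ≤ ENNReal.ofReal L) (hL : 0 ≤ L) (x y : X) :
    ‖f x - f y‖ ≤ L * ‖x - y‖ := by
  rcases eq_or_ne x y with rfl | hne
  · simp
  have h1 : edist (f x) (f y) / edist x y ≤ ENNReal.ofReal L :=
    (le_iSup_of_le x (le_iSup_of_le y (le_iSup (fun _ : x ≠ y => _) hne))).trans h
  have h0 : edist x y ≠ 0 := by simpa [edist_eq_zero] using hne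
  rw [ENNReal.div_le_iff h0 (edist_ne_top _ _), edist_dist, edist_dist,
    ← ENNReal.ofReal_mul hL, ENNReal.ofReal_le_ofReal_iff (by positivity), dist_eq_norm,
    dist_eq_norm] at h1
  exact h1

theorem norm_gradient_sub_sub_hess_le {f : Vec d → ℝ} {L : ℝ}
    (hf : Differentiable ℝ (fun y => ∇ f y)) (hL0 : 0 ≤ L)
    (hL : lipConst (hess f) ≤ ENNReal.ofReal L) (x y : Vec d) :
    ‖∇ f y - ∇ f x - hess f x (y - x)‖ ≤ L / 2 * ‖y - x‖ ^ 2 :=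
  norm_sub_sub_fderiv_le hf x y fun z => lipConst_le_iff hL hL0 z x

theorem abs_sub_sub_inner_gradient_le {f : Vec d → ℝ} {L : ℝ} (hf : Differentiable ℝ f)
    (hL0 : 0 ≤ L) (hL : lipConst (fun y => ∇ f y) ≤ ENNReal.ofReal L) (x y : Vec d) :
    |f y - f x - inner ℝ (∇ f x) (y - x)| ≤ L / 2 * ‖y - x‖ ^ 2 := by
  rw [inner_gradient_left]
  refine norm_sub_sub_fderiv_le hf x y fun z => ?_
  rw [← toDual_gradient, ← toDual_gradient, ← map_sub, LinearIsometryEquiv.norm_map]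
  exact lipConst_le_iff hL hL0 z x

/-! ### Inverses of positive definite operators -/

/-- A coercive operator is injective, hence bijective in finite dimension. So `inverse` is a genuine
inverse here and not its default value `0`. -/
theorem inverse_spec {H : Vec d →L[ℝ] Vec d} {c : ℝ} (hc : 0 < c)
    (hH : ∀ v, c * ‖v‖ ^ 2 ≤ inner ℝ (H v) v) (g : Vec d) : H (H.inverse g) = g := by
  have hinj : Function.Injective H := by
    rw [injective_iff_map_eq_zero]
    intro v hv
    have := hH v
    rw [hv, inner_zero_left] at this
    have h2 : ‖v‖ ^ 2 = 0 := le_antisymm (by nlinarith) (sq_nonneg _)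
    simpa using h2
  let e : Vec d ≃L[ℝ] Vec d :=
    (LinearEquiv.ofInjectiveEndo (H : Vec d →ₗ[ℝ] Vec d) hinj).toContinuousLinearEquiv
  have he : (e : Vec d →L[ℝ] Vec d) = H := by ext1 v; rfl
  exact ContinuousLinearMap.IsInvertible.self_apply_inverse ⟨e, he⟩ g

theorem norm_le_of_map_eq {H : Vec d →L[ℝ] Vec d} {c : ℝ} (hc : 0 < c)
    (hH : ∀ v, c * ‖v‖ ^ 2 ≤ inner ℝ (H v) v) {x g : Vec d} (hx : H x = g) : ‖x‖ ≤ ‖g‖ / c := by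
  rw [le_div_iff₀ hc]
  have h1 := (hH x).trans (real_inner_le_norm _ _)
  rw [hx] at h1
  rcases eq_or_lt_of_le (norm_nonneg x) with h | h
  · rw [← h]; simp
  · exact le_of_mul_le_mul_right (by linarith) h

theorem inner_inverse_le {H : Vec d →L[ℝ] Vec d} {c : ℝ} (hc : 0 < c)
    (hH : ∀ v, c * ‖v‖ ^ 2 ≤ inner ℝ (H v) v) (g : Vec d) :
    inner ℝ g (H.inverse g) ≤ ‖g‖ ^ 2 / c := by
  have h := norm_le_of_map_eq hc hH (inverse_spec hc hH g)
  calc _ ≤ ‖g‖ * ‖H.inverse g‖ := real_inner_le_norm _ _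
    _ ≤ ‖g‖ * (‖g‖ / c) := by gcongr
    _ = _ := by ring

/-- This is the resolvent identity `H₀⁻¹ - H₁⁻¹ = H₁⁻¹ (H₁ - H₀) H₀⁻¹` tested on `g`; only `H₁` has
to be symmetric. -/
theorem inner_inverse_sub_le_of_lipschitz {H₀ H₁ : Vec d →L[ℝ] Vec d} {c₀ c₁ L : ℝ}
    (hc₀ : 0 < c₀) (hc₁ : 0 < c₁) (hs : (H₁ : Vec d →ₗ[ℝ] Vec d).IsSymmetric)
    (h₀ : ∀ v, c₀ * ‖v‖ ^ 2 ≤ inner ℝ (H₀ v) v) (h₁ : ∀ v, c₁ * ‖v‖ ^ 2 ≤ inner ℝ (H₁ v) v)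
    (hL : ‖H₁ - H₀‖ ≤ L) (g : Vec d) :
    inner ℝ g (H₀.inverse g) - inner ℝ g (H₁.inverse g) ≤ L * ‖g‖ ^ 2 / (c₀ * c₁) := by
  set x := H₀.inverse g
  set y := H₁.inverse g
  have hx : H₀ x = g := inverse_spec hc₀ h₀ g
  have hy : H₁ y = g := inverse_spec hc₁ h₁ g
  have e : inner ℝ g x - inner ℝ g y = inner ℝ ((H₁ - H₀) x) y := by
    have : inner ℝ (H₁ x) y = inner ℝ x (H₁ y) := hs x y
    rw [sub_apply, inner_sub_left, this, hx, hy, real_inner_comm x]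
  have hxn := norm_le_of_map_eq hc₀ h₀ hx
  have hyn := norm_le_of_map_eq hc₁ h₁ hy
  have hL0 : 0 ≤ L := (norm_nonneg _).trans hL
  calc _ = inner ℝ ((H₁ - H₀) x) y := e
    _ ≤ ‖(H₁ - H₀) x‖ * ‖y‖ := real_inner_le_norm _ _
    _ ≤ (L * (‖g‖ / c₀)) * (‖g‖ / c₁) := by
      gcongr
      exact ((H₁ - H₀).le_opNorm x).trans (by gcongr)
    _ = _ := by field_simp

/-- By symmetry the difference of the two quadratic forms factors as `⟨g' - g, H⁻¹ (g + g')⟩`. -/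
theorem inner_inverse_sub_inner_inverse_le {H : Vec d →L[ℝ] Vec d} {c l B : ℝ}
    (hc : 0 < c) (hs : (H : Vec d →ₗ[ℝ] Vec d).IsSymmetric)
    (hH : ∀ v, c * ‖v‖ ^ 2 ≤ inner ℝ (H v) v) {g g' : Vec d} (hg : ‖g' - g‖ ≤ l)
    (hB : l * ‖g‖ + l * ‖g'‖ ≤ B) :
    inner ℝ g' (H.inverse g') - inner ℝ g (H.inverse g) ≤ B / c := by
  set x := H.inverse g
  set y := H.inverse g'
  have hx : H x = g := inverse_spec hc hH g
  have hy : H y = g' := inverse_spec hc hH g'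
  have hxn := norm_le_of_map_eq hc hH hx
  have hyn := norm_le_of_map_eq hc hH hy
  have e : inner ℝ g' y - inner ℝ g x = inner ℝ (g' - g) (x + y) := by
    have : inner ℝ (H x) y = inner ℝ x (H y) := hs x y
    rw [hx, hy, real_inner_comm] at this
    rw [inner_sub_left, inner_add_right, inner_add_right, real_inner_comm x g', ← this,
      real_inner_comm g y]
    ring
  have hl0 : 0 ≤ l := (norm_nonneg _).trans hg
  calc _ = inner ℝ (g' - g) (x + y) := e
    _ ≤ ‖g' - g‖ * ‖x + y‖ := real_inner_le_norm _ _
    _ ≤ l * (‖g‖ / c + ‖g'‖ / c) := by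
      gcongr
      exact (norm_add_le _ _).trans (by gcongr)
    _ = (l * ‖g‖ + l * ‖g'‖) / c := by ring
    _ ≤ _ := by gcongr

/-- Only an upper bound on the perturbation `D` is needed, since
`⟨g, H⁻¹ g⟩ = sup_x (2 ⟨g, x⟩ - ⟨H x, x⟩)`. -/
theorem inner_inverse_sub_le_of_perturbation {H₀ H₁ : Vec d →L[ℝ] Vec d} {c₀ c₁ C : ℝ}
    (hc₀ : 0 < c₀) (hc₁ : 0 < c₁) (hC : 0 ≤ C) (hs : (H₁ : Vec d →ₗ[ℝ] Vec d).IsSymmetric)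
    (h₀ : ∀ v, c₀ * ‖v‖ ^ 2 ≤ inner ℝ (H₀ v) v) (h₁ : ∀ v, c₁ * ‖v‖ ^ 2 ≤ inner ℝ (H₁ v) v)
    (hD : ∀ v, inner ℝ (H₁ v) v ≤ inner ℝ (H₀ v) v + C * ‖v‖ ^ 2) (g : Vec d) :
    inner ℝ g (H₀.inverse g) - inner ℝ g (H₁.inverse g) ≤ C * ‖g‖ ^ 2 / (c₀ * c₁) := by
  -- Both terms are lower bounds for `H₀`, the second by `h₁` and `hD`. The maximum secures `K ≥ c₀`
  -- and `K + C ≥ c₁` at once.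
  set K := max c₀ (c₁ - C) with hK
  have hK0 : 0 < K := lt_max_of_lt_left hc₀
  have hKH : ∀ v, K * ‖v‖ ^ 2 ≤ inner ℝ (H₀ v) v := by
    intro v
    rcases max_choice c₀ (c₁ - C) with h | h <;> rw [hK, h]
    · exact h₀ v
    · linarith [h₁ v, hD v]
  set x := H₀.inverse g
  set y := H₁.inverse g
  have hx : H₀ x = g := inverse_spec hc₀ h₀ g
  have hy : H₁ y = g := inverse_spec hc₁ h₁ g
  set a := inner ℝ g x with ha
  have hKC : 0 < K + C := by positivity
  -- The vector `θ • x` is the test point in the variational formula for `⟨g, H₁⁻¹ g⟩`. This `θ`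
  -- maximizes `2 θ a - θ² a (K + C) / K`, with value `θ a`.
  set θ := K / (K + C) with hθ
  have hθ0 : 0 ≤ θ := by positivity
  have hvar : 2 * θ * a - θ ^ 2 * inner ℝ (H₁ x) x ≤ inner ℝ g y := by
    have hpos : 0 ≤ inner ℝ (H₁ (θ • x - y)) (θ • x - y) :=
      (by positivity : 0 ≤ c₁ * ‖θ • x - y‖ ^ 2).trans (h₁ _)
    have hsym : inner ℝ (H₁ x) y = inner ℝ x (H₁ y) := hs x y
    rw [map_sub, map_smul, inner_sub_left, inner_sub_right, inner_sub_right, hy,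
      real_inner_smul_left, real_inner_smul_left, real_inner_smul_right, real_inner_smul_right,
      hsym, hy, real_inner_comm g x, ← ha] at hpos
    linarith
  have hax : K * ‖x‖ ^ 2 ≤ a := by rw [ha, ← hx]; exact hKH x
  have hq : inner ℝ (H₁ x) x ≤ a * ((K + C) / K) := by
    have h1 := hD x
    rw [hx, ← ha] at h1
    have h2 : ‖x‖ ^ 2 ≤ a / K := by rw [le_div_iff₀ hK0]; linarith
    calc _ ≤ a + C * (a / K) := h1.trans (by gcongr)
      _ = _ := by field_simp
  have hθq : θ ^ 2 * inner ℝ (H₁ x) x ≤ θ * a := by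
    calc _ ≤ θ ^ 2 * (a * ((K + C) / K)) := by gcongr
      _ = _ := by rw [hθ]; field_simp
  have ha2 : a ≤ ‖g‖ ^ 2 / K := by
    have h := norm_le_of_map_eq hK0 hKH hx
    calc _ ≤ ‖g‖ * ‖x‖ := real_inner_le_norm _ _
      _ ≤ ‖g‖ * (‖g‖ / K) := by gcongr
      _ = _ := by ring
  have h1θ : 1 - θ = C / (K + C) := by rw [hθ]; field_simp; ring
  have hc1K : c₁ ≤ K + C := by linarith [le_max_right c₀ (c₁ - C)]
  calc a - inner ℝ g y ≤ (1 - θ) * a := by linarith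
    _ ≤ C / (K + C) * (‖g‖ ^ 2 / K) := by rw [h1θ]; gcongr
    _ ≤ C / c₁ * (‖g‖ ^ 2 / c₀) := by
      gcongr
      exact le_max_left _ _
    _ = _ := by field_simp

variable {n : ℕ} {Z : Type*}

/-! ### Regularized estimation problems -/

theorem TwiceDifferentiable.add {f g : Vec d → ℝ} (hf : TwiceDifferentiable f)
    (hg : TwiceDifferentiable g) : TwiceDifferentiable (fun y => f y + g y) := by
  refine ⟨hf.1.add hg.1, ?_⟩
  rw [funext fun y => gradient_add_fun (hf.1 y) (hg.1 y)]
  exact hf.2.add hg.2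

theorem TwiceDifferentiable.const_mul {f : Vec d → ℝ} (hf : TwiceDifferentiable f) (c : ℝ) :
    TwiceDifferentiable (fun y => c * f y) := by
  refine ⟨hf.1.const_mul c, ?_⟩
  rw [funext fun y => gradient_const_mul_fun (hf.1 y) c]
  exact hf.2.const_smul c

theorem TwiceDifferentiable.sum {ι : Type*} {s : Finset ι} {f : ι → Vec d → ℝ}
    (hf : ∀ i ∈ s, TwiceDifferentiable (f i)) :
    TwiceDifferentiable (fun y => ∑ i ∈ s, f i y) := by
  refine ⟨Differentiable.fun_sum fun i hi => (hf i hi).1, ?_⟩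
  rw [funext fun y => gradient_sum_fun fun i hi => (hf i hi).1 y]
  exact Differentiable.fun_sum fun i hi => (hf i hi).2

theorem hess_add_fun {f g : Vec d → ℝ} (hf : TwiceDifferentiable f)
    (hg : TwiceDifferentiable g) (x : Vec d) :
    hess (fun y => f y + g y) x = hess f x + hess g x := by
  rw [hess, funext fun y => gradient_add_fun (hf.1 y) (hg.1 y), fderiv_fun_add (hf.2 x) (hg.2 x)]
  rfl

theorem hess_const_mul_fun {f : Vec d → ℝ} (hf : TwiceDifferentiable f) (c : ℝ) (x : Vec d) :
    hess (fun y => c * f y) x = c • hess f x := by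
  rw [hess, funext fun y => gradient_const_mul_fun (hf.1 y) c, fderiv_fun_const_smul (hf.2 x)]
  rfl

theorem hess_sum_fun {ι : Type*} {s : Finset ι} {f : ι → Vec d → ℝ}
    (hf : ∀ i ∈ s, TwiceDifferentiable (f i)) (x : Vec d) :
    hess (fun y => ∑ i ∈ s, f i y) x = ∑ i ∈ s, hess (f i) x := by
  rw [hess, funext fun y => gradient_sum_fun fun i hi => (hf i hi).1 y,
    fderiv_fun_sum fun i hi => (hf i hi).2 x]
  rfl

/-! ### Curvature bounds and the constants `κ_p`. -/

/-- The lower curvature bound at the finite regularization level `t`. -/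
noncomputable def curvBound (closs creg : ℝ) (lamreg t : ℝ≥0) : ℝ :=
  closs + t * (if lamreg ≤ t then creg else 0)

theorem le_curvBound {closs creg : ℝ} {lamreg t : ℝ≥0} (hr : 0 ≤ creg) :
    closs ≤ curvBound closs creg lamreg t := by
  unfold curvBound
  split_ifs
  · have : 0 ≤ (t : ℝ) * creg := by positivity
    linarith
  · simp

theorem bddAbove_kappa {p : ℕ} {C C' closs creg : ℝ} {lamreg : ℝ≥0} (hC : 0 ≤ C) (hC' : 0 ≤ C')
    (hl : 0 < closs) (hr : 0 < creg) :
    BddAbove (Set.range fun t : ℝ≥0 => (C + t * C') /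
      ((p.factorial : ℝ) * (closs + t * (if lamreg ≤ t then creg else 0)))) := by
  -- Below `lamreg` the denominator is at least `closs` and `t ≤ lamreg`, so the first summand
  -- suffices. From `lamreg` on, the regularizer's curvature absorbs `t * C'` at the cost of `C' /
  -- creg`.
  refine ⟨(C + lamreg * C') / closs + C' / creg, ?_⟩
  rintro _ ⟨t, rfl⟩
  have hp : (1 : ℝ) ≤ p.factorial := by exact_mod_cast p.factorial_pos
  have hD : 0 < curvBound closs creg lamreg t := hl.trans_le (le_curvBound hr.le)
  change (C + t * C') / ((p.factorial : ℝ) * curvBound closs creg lamreg t) ≤ _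
  have h1 : (C + t * C') / ((p.factorial : ℝ) * curvBound closs creg lamreg t) ≤
      (C + t * C') / curvBound closs creg lamreg t := by
    gcongr
    nlinarith
  refine h1.trans ?_
  rw [div_le_iff₀ hD]
  have e1 : (C + lamreg * C') / closs * closs = C + lamreg * C' := by field_simp
  have e2 : C' / creg * creg = C' := by field_simp
  have n1 : 0 ≤ (C + lamreg * C') / closs := by positivity
  have n2 : 0 ≤ C' / creg := by positivity
  have n3 : 0 ≤ (lamreg : ℝ) * C' := by positivity
  have ht := t.2
  unfold curvBound
  split_ifs with h
  · have : 0 ≤ (C + lamreg * C') / closs * (t * creg) := by positivity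
    have e3 : C' / creg * (t * creg) = t * C' := by field_simp
    have : 0 ≤ C' / creg * closs := by positivity
    nlinarith
  · have hlt : (t : ℝ) ≤ lamreg := by exact_mod_cast (not_le.1 h).le
    have : 0 ≤ C' / creg * closs := by positivity
    nlinarith [mul_le_mul_of_nonneg_right hlt hC']

/-- Boundedness matters: a real supremum over an unbounded set would default to `0`. -/
theorem le_kappa_mul {p : ℕ} {C C' closs creg : ℝ} {lamreg : ℝ≥0} (hC : 0 ≤ C) (hC' : 0 ≤ C')
    (hl : 0 < closs) (hr : 0 < creg) (t : ℝ≥0) :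
    C + t * C' ≤ p.factorial * kappa p C C' closs creg lamreg * curvBound closs creg lamreg t := by
  have hD : 0 < curvBound closs creg lamreg t := hl.trans_le (le_curvBound hr.le)
  have hp : (0 : ℝ) < p.factorial := by exact_mod_cast p.factorial_pos
  have h := le_ciSup (bddAbove_kappa (p := p) (lamreg := lamreg) hC hC' hl hr) t
  change (C + t * C') / ((p.factorial : ℝ) * curvBound closs creg lamreg t) ≤
    kappa p C C' closs creg lamreg at h
  rw [div_le_iff₀ (by positivity)] at h
  linarith

theorem kappa_nonneg {p : ℕ} {C C' closs creg : ℝ} {lamreg : ℝ≥0} (hC : 0 ≤ C) (hC' : 0 ≤ C')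
    (hl : 0 < closs) (hr : 0 < creg) : 0 ≤ kappa p C C' closs creg lamreg :=
  Real.iSup_nonneg fun t => by
    have hD : 0 < curvBound closs creg lamreg t := hl.trans_le (le_curvBound hr.le)
    change 0 ≤ (C + t * C') / ((p.factorial : ℝ) * curvBound closs creg lamreg t)
    positivity

/-- A lower bound shared by all leave-one-out sums passes to the full sum. -/
theorem le_of_leaveOneOut (hn : 2 ≤ n) {a : Fin n → ℝ} {e q : ℝ} (hq : 0 ≤ q)
    (h : ∀ i, q ≤ e - a i) (h0 : ∀ i, q ≤ ∑ j, a j - a i) : q ≤ e := by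
  have hn' : (2 : ℝ) ≤ n := by exact_mod_cast hn
  have s1 := Finset.sum_le_sum fun i (_ : i ∈ Finset.univ) => h i
  have s0 := Finset.sum_le_sum fun i (_ : i ∈ Finset.univ) => h0 i
  simp only [Finset.sum_sub_distrib, Finset.sum_const, Finset.card_univ, Fintype.card_fin,
    nsmul_eq_mul] at s1 s0
  -- Summing `h0` gives `n q ≤ (n - 1) ∑ a`, so `∑ a ≥ 0`; summing `h` gives `n q ≤ n e - ∑ a`.
  have hs : 0 ≤ ∑ j, a j := by
    have : 0 ≤ (n - 1 : ℝ) * ∑ j, a j := by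
      have : 0 ≤ (n : ℝ) * q := by positivity
      linarith
    exact nonneg_of_mul_nonneg_right this (by linarith)
  have : (n : ℝ) * q ≤ n * e := by linarith
  exact le_of_mul_le_mul_left this (by linarith)

theorem penalized_nonneg {lam : ℝ≥0∞} {a b : ℝ} (ha : 0 ≤ a) (hb : 0 ≤ b) :
    0 ≤ penalized lam a b := by
  unfold penalized; split_ifs <;> positivity

namespace Problem

/-- Smoothness, curvature and Hessian assumptions on a regularized estimation problem with at
least two datapoints. -/
structure Regular (P : Problem d n Z) (Λ : Set ℝ≥0∞) (est : ℝ≥0∞ → Vec d)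
    (closs creg cobj : ℝ) (lamreg : ℝ≥0) (Closs2 Creg2 Closs3 Creg3 : ℝ) : Prop where
  two_le : 2 ≤ n
  loss : ∀ i, TwiceDifferentiable (P.lossAt i)
  reg : TwiceDifferentiable P.reg
  zero_mem : 0 ∈ Λ
  isEstimator : P.IsEstimator Λ est
  curvature : P.Curvature Λ est closs creg cobj lamreg
  lipschitzHessian : P.LipschitzHessian Λ Closs3 Creg3
  boundedHessian : P.BoundedHessian Λ est Closs2 Creg2
  grad_pos : 0 < ‖∇ P.reg (est 0)‖

variable {P : Problem d n Z} {Λ : Set ℝ≥0∞} {est : ℝ≥0∞ → Vec d} {closs creg cobj : ℝ}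
  {lamreg : ℝ≥0} {Closs2 Creg2 Closs3 Creg3 : ℝ}

theorem empLoss_eq_looLoss_add (i : Fin n) (β : Vec d) :
    P.empLoss β = P.looLoss i β + 1 / n * P.lossAt i β := by
  rw [empLoss, looLoss, ← mul_add, Finset.filter_ne', Finset.sum_erase_add _ _ (Finset.mem_univ i)]

theorem empObj_eq_looObj_add {lam : ℝ≥0∞} (hlam : lam ≠ ∞) (i : Fin n) (β : Vec d) :
    P.empObj lam β = P.looObj i lam β + 1 / n * P.lossAt i β := by
  rw [empObj, looObj, penalized, penalized, if_neg hlam, if_neg hlam,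
    P.empLoss_eq_looLoss_add i]
  ring

theorem empObj_eq {lam : ℝ≥0∞} (hlam : lam ≠ ∞) :
    P.empObj lam = fun β => P.empLoss β + lam.toReal * P.reg β := by
  funext β; rw [empObj, penalized, if_neg hlam]

theorem looObj_eq {lam : ℝ≥0∞} (hlam : lam ≠ ∞) (i : Fin n) :
    P.looObj i lam = fun β => P.looLoss i β + lam.toReal * P.reg β := by
  funext β; rw [looObj, penalized, if_neg hlam]

theorem empObj_top : P.empObj ∞ = P.reg := by
  funext β; rw [empObj, penalized, if_pos rfl]

theorem looObj_top (i : Fin n) : P.looObj i ∞ = P.reg := by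
  funext β; rw [looObj, penalized, if_pos rfl]

theorem empObj_zero : P.empObj 0 = P.empLoss := by
  rw [empObj_eq ENNReal.zero_ne_top]; simp

namespace Regular

variable (R : P.Regular Λ est closs creg cobj lamreg Closs2 Creg2 Closs3 Creg3)

include R

theorem closs_pos : 0 < closs := R.curvature.1
theorem creg_pos : 0 < creg := R.curvature.2.1
theorem cobj_pos : 0 < cobj := R.curvature.2.2.1
theorem n_pos : (0 : ℝ) < n := by exact_mod_cast (Nat.zero_lt_two.trans_le R.two_le)

/-! ### Derivatives of the objectives. -/

theorem twice_empLoss : TwiceDifferentiable P.empLoss :=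
  (TwiceDifferentiable.sum fun j _ => R.loss j).const_mul (1 / (n : ℝ))

theorem twice_looLoss (i : Fin n) : TwiceDifferentiable (P.looLoss i) :=
  (TwiceDifferentiable.sum fun j _ => R.loss j).const_mul (1 / (n : ℝ))

theorem twice_empObj (lam : ℝ≥0∞) : TwiceDifferentiable (P.empObj lam) := by
  by_cases h : lam = ∞
  · rw [h, empObj_top]; exact R.reg
  · rw [empObj_eq h]; exact R.twice_empLoss.add (R.reg.const_mul _)

theorem twice_looObj (i : Fin n) (lam : ℝ≥0∞) : TwiceDifferentiable (P.looObj i lam) := by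
  by_cases h : lam = ∞
  · rw [h, looObj_top]; exact R.reg
  · rw [looObj_eq h]; exact (R.twice_looLoss i).add (R.reg.const_mul _)

theorem gradient_empObj {lam : ℝ≥0∞} (h : lam ≠ ∞) (x : Vec d) :
    ∇ (P.empObj lam) x = ∇ P.empLoss x + lam.toReal • ∇ P.reg x := by
  rw [empObj_eq h, gradient_add_fun (R.twice_empLoss.1 x) ((R.reg.const_mul _).1 x),
    gradient_const_mul_fun (R.reg.1 x)]

theorem gradient_empObj_eq {lam : ℝ≥0∞} (h : lam ≠ ∞) (i : Fin n) (x : Vec d) :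
    ∇ (P.empObj lam) x = ∇ (P.looObj i lam) x + (1 / n : ℝ) • ∇ (P.lossAt i) x := by
  rw [funext (P.empObj_eq_looObj_add h i), gradient_add_fun ((R.twice_looObj i lam).1 x)
    (((R.loss i).const_mul _).1 x), gradient_const_mul_fun ((R.loss i).1 x)]

theorem gradient_empLoss (x : Vec d) :
    ∇ P.empLoss x = ∑ i, (1 / n : ℝ) • ∇ (P.lossAt i) x := by
  change ∇ (fun β => 1 / (n : ℝ) * ∑ j, P.lossAt j β) x = _
  rw [gradient_const_mul_fun ((TwiceDifferentiable.sum fun j _ => R.loss j).1 x),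
    gradient_sum_fun fun j _ => (R.loss j).1 x, Finset.smul_sum]

theorem hess_empObj_eq {lam : ℝ≥0∞} (h : lam ≠ ∞) (i : Fin n) (x : Vec d) :
    hess (P.empObj lam) x = hess (P.looObj i lam) x + (1 / n : ℝ) • hess (P.lossAt i) x := by
  rw [funext (P.empObj_eq_looObj_add h i), hess_add_fun (R.twice_looObj i lam)
    ((R.loss i).const_mul _), hess_const_mul_fun (R.loss i)]

theorem hess_looObj {lam : ℝ≥0∞} (h : lam ≠ ∞) (i : Fin n) (x : Vec d) :
    hess (P.looObj i lam) x = hess (P.looLoss i) x + lam.toReal • hess P.reg x := by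
  rw [looObj_eq h, hess_add_fun (R.twice_looLoss i) (R.reg.const_mul _), hess_const_mul_fun R.reg]

theorem hess_empLoss (x : Vec d) :
    hess P.empLoss x = ∑ i, (1 / n : ℝ) • hess (P.lossAt i) x := by
  change hess (fun β => 1 / (n : ℝ) * ∑ j, P.lossAt j β) x = _
  rw [hess_const_mul_fun (TwiceDifferentiable.sum fun j _ => R.loss j),
    hess_sum_fun fun j _ => R.loss j, Finset.smul_sum]

/-! ### Strong monotonicity, stationarity and Hessian bounds. -/

theorem strongMono_looObj {lam : ℝ≥0∞} (hm : lam ∈ Λ) (h : lam ≠ ∞) (i : Fin n) :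
    StrongMono cobj (fun y => ∇ (P.looObj i lam) y) := by
  have := R.curvature.2.2.2.1 i lam hm
  simp only [penalized, if_neg h, mul_zero, add_zero] at this
  exact this.strongMono (R.twice_looObj i lam).1

theorem strongMono_reg (hm : ∞ ∈ Λ) : StrongMono 0 (fun y => ∇ P.reg y) := by
  have := R.curvature.2.2.2.1 ⟨0, Nat.zero_lt_two.trans_le R.two_le⟩ ∞ hm
  simp only [penalized, if_true, looObj_top] at this
  exact this.strongMono R.reg.1

/-- A single loss need not be convex, so restoring the omitted term could destroy curvature.
Averaging over the omitted index avoids this: the leave-one-out bounds at level `0` show that the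
losses together contribute nonnegatively. -/
theorem strongMono_empObj {lam : ℝ≥0∞} (hm : lam ∈ Λ) (h : lam ≠ ∞) :
    StrongMono cobj (fun y => ∇ (P.empObj lam) y) := by
  intro x y
  have key : ∀ lam ∈ Λ, lam ≠ ∞ → ∀ i, cobj * ‖x - y‖ ^ 2 ≤
      inner ℝ (x - y) (∇ (P.empObj lam) x - ∇ (P.empObj lam) y) -
        inner ℝ (x - y) ((1 / n : ℝ) • (∇ (P.lossAt i) x - ∇ (P.lossAt i) y)) := by
    intro lam hm h i
    have := R.strongMono_looObj hm h i x y
    simp only at this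
    rw [R.gradient_empObj_eq h i, R.gradient_empObj_eq h i, ← inner_sub_right]
    convert this using 2
    rw [smul_sub]; abel
  refine le_of_leaveOneOut R.two_le (by have := R.cobj_pos; positivity) (key lam hm h) fun i => ?_
  convert key 0 R.zero_mem ENNReal.zero_ne_top i using 2
  rw [empObj_zero, R.gradient_empLoss, R.gradient_empLoss, ← inner_sum, ← Finset.sum_sub_distrib]
  simp only [smul_sub]

theorem strongMono_zero_empObj {lam : ℝ≥0∞} (hm : lam ∈ Λ) :
    StrongMono 0 (fun y => ∇ (P.empObj lam) y) := by
  by_cases h : lam = ∞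
  · subst h; rw [empObj_top]; exact R.strongMono_reg hm
  · intro x y
    have h1 := R.strongMono_empObj hm h x y
    have h2 : 0 ≤ cobj * ‖x - y‖ ^ 2 := by have := R.cobj_pos; positivity
    linarith

theorem gradient_empObj_est {lam : ℝ≥0∞} (hm : lam ∈ Λ) : ∇ (P.empObj lam) (est lam) = 0 :=
  gradient_eq_zero_of_isMinOn (R.isEstimator lam hm)

theorem gradient_looObj_est {lam : ℝ≥0∞} (hm : lam ∈ Λ) (h : lam ≠ ∞) (i : Fin n) :
    ∇ (P.looObj i lam) (est lam) = -((1 / n : ℝ) • ∇ (P.lossAt i) (est lam)) := by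
  rw [eq_neg_iff_add_eq_zero, ← R.gradient_empObj_eq h i, R.gradient_empObj_est hm]

theorem norm_gradient_empObj_sub_le {lam : ℝ≥0∞} (hm : lam ∈ Λ) (x y : Vec d) :
    ‖∇ (P.empObj lam) x - ∇ (P.empObj lam) y‖ ≤ penalized lam Closs2 Creg2 * ‖x - y‖ :=
  norm_gradient_sub_le (penalized_nonneg R.boundedHessian.1 R.boundedHessian.2.1)
    (R.twice_empObj lam).2 (R.strongMono_zero_empObj hm) (R.boundedHessian.2.2.1 lam hm) x y

theorem le_hess_looObj {lam lam' : ℝ≥0∞} (hm : lam ∈ Λ) (hm' : lam' ∈ Λ) (i : Fin n)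
    (v : Vec d) : penalized lam' closs (if (lamreg : ℝ≥0∞) ≤ lam then creg else 0) * ‖v‖ ^ 2 ≤
      inner ℝ (hess (P.looObj i lam') (est lam) v) v := by
  have := ((ContinuousLinearMap.le_def _ _).1
    (R.curvature.2.2.2.2 i lam hm lam' hm')).inner_nonneg_left v
  simp only [sub_apply, smul_apply, ContinuousLinearMap.id_apply, inner_sub_left,
    real_inner_smul_left, real_inner_self_eq_norm_sq] at this
  linarith

theorem hess_looObj_isSymmetric {lam lam' : ℝ≥0∞} (hm : lam ∈ Λ) (hm' : lam' ∈ Λ) (i : Fin n) :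
    (hess (P.looObj i lam') (est lam) : Vec d →ₗ[ℝ] Vec d).IsSymmetric := by
  intro x y
  have := ((ContinuousLinearMap.le_def _ _).1
    (R.curvature.2.2.2.2 i lam hm lam' hm')).isSymmetric x y
  simp only [ContinuousLinearMap.coe_coe, sub_apply, smul_apply, ContinuousLinearMap.id_apply,
    inner_sub_left, inner_sub_right, real_inner_smul_left, real_inner_smul_right] at this ⊢
  linarith

/-- The indicator in the curvature assumption refers to the level of the base point, while
`curvBound` tests the level `t` of the objective. The condition `t ≤ lam` makes the former at least
the latter. -/
theorem curvBound_le_hess {lam : ℝ≥0∞} {t : ℝ≥0} (hm : lam ∈ Λ) (hm' : (t : ℝ≥0∞) ∈ Λ)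
    (hle : t ≤ lam) (i : Fin n) (v : Vec d) :
    curvBound closs creg lamreg t * ‖v‖ ^ 2 ≤ inner ℝ (hess (P.looObj i t) (est lam) v) v := by
  refine le_trans ?_ (R.le_hess_looObj hm hm' i v)
  gcongr
  rw [penalized, if_neg ENNReal.coe_ne_top, curvBound, ENNReal.coe_toReal]
  have hr := R.creg_pos
  by_cases h : lamreg ≤ t
  · rw [if_pos h, if_pos ((ENNReal.coe_le_coe.2 h).trans hle)]
  · rw [if_neg h]
    split_ifs
    · gcongr
    · rfl

theorem closs_le_hess {lam lam' : ℝ≥0∞} (hm : lam ∈ Λ) (hm' : lam' ∈ Λ) (h : lam' ≠ ∞)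
    (i : Fin n) (v : Vec d) :
    closs * ‖v‖ ^ 2 ≤ inner ℝ (hess (P.looObj i lam') (est lam) v) v := by
  refine le_trans ?_ (R.le_hess_looObj hm hm' i v)
  gcongr
  rw [penalized, if_neg h]
  have hr := R.creg_pos
  have : 0 ≤ lam'.toReal * (if (lamreg : ℝ≥0∞) ≤ lam then creg else 0) := by
    split_ifs <;> positivity
  linarith

theorem cobj_le_hess {lam : ℝ≥0∞} (hm : lam ∈ Λ) (h : lam ≠ ∞) (i : Fin n) (x v : Vec d) :
    cobj * ‖v‖ ^ 2 ≤ inner ℝ (hess (P.looObj i lam) x v) v :=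
  (R.strongMono_looObj hm h i).le_hess ((R.twice_looObj i lam).2 x) v

/-! ### Sensitivity of the regularization path. -/

theorem le_Closs2_of_le_hess {c : ℝ} (hc : 0 ≤ c)
    (hh : ∀ i, ∀ v, c * ‖v‖ ^ 2 ≤ inner ℝ (hess (P.looObj i 0) (est 0) v) v) : c ≤ Closs2 := by
  -- Any nonzero test vector would do; identifiability supplies one and thereby excludes `d = 0`.
  set v := ∇ P.reg (est 0)
  have key : ∀ i, c * ‖v‖ ^ 2 ≤ inner ℝ (hess P.empLoss (est 0) v) v -
      inner ℝ (((1 / n : ℝ) • hess (P.lossAt i) (est 0)) v) v := by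
    intro i
    have := hh i v
    rw [← empObj_zero, R.hess_empObj_eq ENNReal.zero_ne_top i, add_apply, inner_add_left]
    linarith
  have h1 : c * ‖v‖ ^ 2 ≤ inner ℝ (hess P.empLoss (est 0) v) v := by
    refine le_of_leaveOneOut R.two_le (by positivity) key fun i => ?_
    convert key i using 2
    rw [R.hess_empLoss, sum_apply, sum_inner]
  have h2 := ((ContinuousLinearMap.le_def _ _).1
    (R.boundedHessian.2.2.1 0 R.zero_mem (est 0))).inner_nonneg_left v
  rw [empObj_zero, penalized, if_neg ENNReal.zero_ne_top] at h2
  simp only [sub_apply, smul_apply, ContinuousLinearMap.id_apply, inner_sub_left,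
    real_inner_smul_left, real_inner_self_eq_norm_sq, ENNReal.toReal_zero, zero_mul,
    add_zero] at h2
  have h3 : 0 < ‖v‖ ^ 2 := pow_pos R.grad_pos 2
  exact le_of_mul_le_mul_right (by linarith) h3

theorem cobj_le_Closs2 : cobj ≤ Closs2 :=
  R.le_Closs2_of_le_hess R.cobj_pos.le fun i v =>
    R.cobj_le_hess R.zero_mem ENNReal.zero_ne_top i _ v

theorem closs_le_Closs2 : closs ≤ Closs2 :=
  R.le_Closs2_of_le_hess R.closs_pos.le fun i v =>
    R.closs_le_hess R.zero_mem R.zero_mem ENNReal.zero_ne_top i v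

theorem one_le_kappa : 1 ≤ kappa 1 Closs2 Creg2 closs creg lamreg := by
  have h := le_kappa_mul (p := 1) (lamreg := lamreg) R.boundedHessian.1 R.boundedHessian.2.1
    R.closs_pos R.creg_pos 0
  simp only [curvBound, NNReal.coe_zero, zero_mul, add_zero, Nat.factorial_one, Nat.cast_one,
    one_mul] at h
  exact le_of_mul_le_mul_right (by linarith [R.closs_le_Closs2]) R.closs_pos

/-- Identifiability propagates from level `0` to level `t`. The distance `‖β(0) - β(t)‖` is bounded
below through `t ∇π(β(0))`, by smoothness at level `t`, and above through `t ∇π(β(t))`, by strong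
convexity at level `0`; the factor `t` cancels. -/
theorem mul_norm_gradient_reg_zero_le {t : ℝ≥0} (hm : (t : ℝ≥0∞) ∈ Λ) :
    cobj * ‖∇ P.reg (est 0)‖ ≤ (Closs2 + t * Creg2) * ‖∇ P.reg (est t)‖ := by
  rcases eq_or_ne t 0 with rfl | ht
  · simp only [ENNReal.coe_zero, NNReal.coe_zero, zero_mul, add_zero]
    gcongr
    exact R.cobj_le_Closs2
  have ht0 : (0 : ℝ) < t := by exact_mod_cast pos_iff_ne_zero.2 ht
  have hfin : (t : ℝ≥0∞) ≠ ∞ := ENNReal.coe_ne_top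
  have hz := R.gradient_empObj_est R.zero_mem
  have e0 : ∇ P.empLoss (est 0) = 0 := by rwa [empObj_zero] at hz
  have et := R.gradient_empObj_est hm
  have h1 : t * ‖∇ P.reg (est 0)‖ ≤ (Closs2 + t * Creg2) * ‖est 0 - est t‖ := by
    have := R.norm_gradient_empObj_sub_le hm (est 0) (est t)
    rw [et, sub_zero, R.gradient_empObj hfin, e0, zero_add, norm_smul, ENNReal.coe_toReal,
      penalized, if_neg hfin, ENNReal.coe_toReal, Real.norm_eq_abs, NNReal.abs_eq] at this
    exact this
  have h2 : cobj * ‖est 0 - est t‖ ≤ t * ‖∇ P.reg (est t)‖ := by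
    have := (R.strongMono_empObj R.zero_mem ENNReal.zero_ne_top).mul_norm_le (est 0) (est t)
    rw [R.gradient_empObj hfin, ENNReal.coe_toReal, add_eq_zero_iff_eq_neg] at et
    simp only [empObj_zero] at this
    rwa [e0, et, sub_neg_eq_add, zero_add, norm_smul, Real.norm_eq_abs, NNReal.abs_eq] at this
  have hC : 0 ≤ Closs2 + t * Creg2 := by
    have := R.boundedHessian.1
    have := R.boundedHessian.2.1
    positivity
  refine le_of_mul_le_mul_left ?_ ht0
  calc t * (cobj * ‖∇ P.reg (est 0)‖) = cobj * (t * ‖∇ P.reg (est 0)‖) := by ring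
    _ ≤ cobj * ((Closs2 + t * Creg2) * ‖est 0 - est t‖) := by
      have := R.cobj_pos; gcongr
    _ = (Closs2 + t * Creg2) * (cobj * ‖est 0 - est t‖) := by ring
    _ ≤ (Closs2 + t * Creg2) * (t * ‖∇ P.reg (est t)‖) := by gcongr
    _ = _ := by ring

/-- Stationarity at level `t` turns the level-`s` gradient at `β(t)` into `(s - t) ∇π(β(t))`. -/
theorem sub_mul_norm_gradient_reg_le {s t : ℝ≥0} (hs : (s : ℝ≥0∞) ∈ Λ) (ht : (t : ℝ≥0∞) ∈ Λ) :
    (s - t : ℝ) * ‖∇ P.reg (est t)‖ ≤ (Closs2 + s * Creg2) * ‖est s - est t‖ := by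
  have h := R.norm_gradient_empObj_sub_le hs (est t) (est s)
  have et := R.gradient_empObj_est ht
  rw [R.gradient_empObj ENNReal.coe_ne_top, ENNReal.coe_toReal, add_eq_zero_iff_eq_neg] at et
  rw [R.gradient_empObj_est hs, sub_zero, R.gradient_empObj ENNReal.coe_ne_top, et, penalized,
    if_neg ENNReal.coe_ne_top, ENNReal.coe_toReal, neg_add_eq_sub, ← sub_smul, norm_smul,
    norm_sub_rev (est t)] at h
  refine le_trans ?_ h
  gcongr
  exact le_abs_self _

theorem norm_gradient_reg_le_of_top (hs : ∞ ∈ Λ) (x : Vec d) :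
    ‖∇ P.reg x‖ ≤ Creg2 * ‖est ∞ - x‖ := by
  have h := R.norm_gradient_empObj_sub_le hs x (est ∞)
  rwa [R.gradient_empObj_est hs, sub_zero, empObj_top, penalized, if_pos rfl, norm_sub_rev] at h

/-- How far the regularization level can move per unit of movement of the estimator. -/
theorem sub_le_mul_norm {s t : ℝ≥0} (hs : (s : ℝ≥0∞) ∈ Λ) (ht : (t : ℝ≥0∞) ∈ Λ) (hts : t ≤ s) :
    (s - t : ℝ) ≤ kappa 1 Closs2 Creg2 closs creg lamreg ^ 2 / (‖∇ P.reg (est 0)‖ * cobj) *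
      (curvBound closs creg lamreg s * curvBound closs creg lamreg t) * ‖est s - est t‖ := by
  have hC2 := R.boundedHessian.1
  have hR2 := R.boundedHessian.2.1
  have hc := R.cobj_pos
  have hp := R.grad_pos
  have h1 := R.mul_norm_gradient_reg_zero_le ht
  have h2 := R.sub_mul_norm_gradient_reg_le hs ht
  have ks := le_kappa_mul (p := 1) (lamreg := lamreg) hC2 hR2 R.closs_pos R.creg_pos s
  have kt := le_kappa_mul (p := 1) (lamreg := lamreg) hC2 hR2 R.closs_pos R.creg_pos t
  have hts' : (0 : ℝ) ≤ s - t := sub_nonneg.2 (by exact_mod_cast hts)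
  have hsn : 0 ≤ Closs2 + s * Creg2 := by positivity
  have htn : 0 ≤ Closs2 + t * Creg2 := by positivity
  simp only [Nat.factorial_one, Nat.cast_one, one_mul] at ks kt
  set κ := kappa 1 Closs2 Creg2 closs creg lamreg
  set Ds := curvBound closs creg lamreg s
  set Dt := curvBound closs creg lamreg t
  -- The lower bound `h1` on `‖∇π(β(t))‖` feeds into `h2`, and each smoothness factor is at most `κ`
  -- times the curvature at its level. The resulting product `Ds * Dt` later cancels against two
  -- inverse Hessians.
  have key : (s - t : ℝ) * (‖∇ P.reg (est 0)‖ * cobj) ≤ κ ^ 2 * (Ds * Dt) * ‖est s - est t‖ := by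
    calc (s - t : ℝ) * (‖∇ P.reg (est 0)‖ * cobj) = (s - t) * (cobj * ‖∇ P.reg (est 0)‖) := by ring
      _ ≤ (s - t) * ((Closs2 + t * Creg2) * ‖∇ P.reg (est t)‖) := by gcongr
      _ = (Closs2 + t * Creg2) * ((s - t) * ‖∇ P.reg (est t)‖) := by ring
      _ ≤ (Closs2 + t * Creg2) * ((Closs2 + s * Creg2) * ‖est s - est t‖) := by gcongr
      _ ≤ (κ * Dt) * ((κ * Ds) * ‖est s - est t‖) := by
        have := htn.trans kt
        gcongr
      _ = _ := by ring
  rw [← le_div_iff₀ (by positivity)] at key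
  refine key.trans_eq ?_
  field_simp

/-- At `∞` the Newton step is zero, so no difference of levels is available. Instead `β(t)` must
stay away from `β(∞)`, since `∇π` vanishes at `β(∞)` but not at `β(t)`. -/
theorem one_le_mul_norm_of_top {t : ℝ≥0} (hs : ∞ ∈ Λ) (ht : (t : ℝ≥0∞) ∈ Λ) :
    1 ≤ Creg2 * kappa 1 Closs2 Creg2 closs creg lamreg ^ 2 / (‖∇ P.reg (est 0)‖ * cobj) *
      curvBound closs creg lamreg t * ‖est ∞ - est t‖ := by
  have hC2 := R.boundedHessian.1
  have hR2 := R.boundedHessian.2.1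
  have hc := R.cobj_pos
  have hp := R.grad_pos
  have h1 := R.mul_norm_gradient_reg_zero_le ht
  have h2 := R.norm_gradient_reg_le_of_top hs (est t)
  have kt := le_kappa_mul (p := 1) (lamreg := lamreg) hC2 hR2 R.closs_pos R.creg_pos t
  have htn : 0 ≤ Closs2 + t * Creg2 := by positivity
  have hk := R.one_le_kappa
  simp only [Nat.factorial_one, Nat.cast_one, one_mul] at kt
  set κ := kappa 1 Closs2 Creg2 closs creg lamreg
  set Dt := curvBound closs creg lamreg t
  have hDt : 0 < Dt := R.closs_pos.trans_le (le_curvBound R.creg_pos.le)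
  have key : 1 * (‖∇ P.reg (est 0)‖ * cobj) ≤ Creg2 * κ ^ 2 * Dt * ‖est ∞ - est t‖ := by
    calc 1 * (‖∇ P.reg (est 0)‖ * cobj) = cobj * ‖∇ P.reg (est 0)‖ := by ring
      _ ≤ (Closs2 + t * Creg2) * (Creg2 * ‖est ∞ - est t‖) := h1.trans (by gcongr)
      _ ≤ (κ * Dt) * (Creg2 * ‖est ∞ - est t‖) := by gcongr
      _ ≤ (κ ^ 2 * Dt) * (Creg2 * ‖est ∞ - est t‖) := by
        gcongr
        nlinarith
      _ = _ := by ring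
  rw [← le_div_iff₀ (by positivity)] at key
  refine key.trans_eq ?_
  field_simp

/-- Strong convexity at the smaller level bounds the objective gap from below. The penalty decreases
along the path, so the whole gap is carried by the loss. -/
theorem empLoss_sub_ge {lam lam' : ℝ≥0∞} (hm : lam ∈ Λ) (hm' : lam' ∈ Λ) (hlt : lam' < lam) :
    cobj / 2 * ‖est lam - est lam'‖ ^ 2 ≤ P.empLoss (est lam) - P.empLoss (est lam') := by
  have h' : lam' ≠ ∞ := hlt.ne_top
  have hc := R.cobj_pos
  set D := cobj / 2 * ‖est lam - est lam'‖ ^ 2 with hD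
  have hD0 : 0 ≤ D := by positivity
  have g' : P.empObj lam' (est lam') + D ≤ P.empObj lam' (est lam) := by
    have := (R.strongMono_empObj hm' h').add_quadratic_le (R.twice_empObj lam').1 (est lam)
      (est lam')
    rwa [R.gradient_empObj_est hm', inner_zero_left, add_zero] at this
  rw [empObj_eq h'] at g'
  simp only at g'
  have hreg : P.reg (est lam) ≤ P.reg (est lam') := by
    by_cases h : lam = ∞
    · subst h
      have := R.isEstimator ∞ hm (Set.mem_univ (est lam'))
      simpa [empObj_top] using this
    · have g : P.empObj lam (est lam) ≤ P.empObj lam (est lam') :=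
        R.isEstimator lam hm (Set.mem_univ (est lam'))
      rw [empObj_eq h] at g
      simp only at g
      have hl : lam'.toReal < lam.toReal := (ENNReal.toReal_lt_toReal h' h).2 hlt
      have : (lam.toReal - lam'.toReal) * P.reg (est lam) ≤
          (lam.toReal - lam'.toReal) * P.reg (est lam') := by linarith
      exact le_of_mul_le_mul_left this (sub_pos.2 hl)
  have := mul_le_mul_of_nonneg_left hreg (ENNReal.toReal_nonneg (a := lam'))
  linarith

end Regular

/-! ### Moments -/

/-- The Lipschitz constant of the gradient of the `i`-th loss, `0` if it is infinite. -/
noncomputable def lipGrad (P : Problem d n Z) (i : Fin n) : ℝ :=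
  (lipConst (fun β => ∇ (P.lossAt i) β)).toReal

theorem lipGrad_nonneg (i : Fin n) : 0 ≤ P.lipGrad i := ENNReal.toReal_nonneg

theorem avg_lt_top_of_moment {s r : ℕ} (hB : P.moment Λ est s r < ∞) {lam : ℝ≥0∞} (hm : lam ∈ Λ) :
    (n : ℝ≥0∞)⁻¹ * ∑ i, lipConst (fun β => ∇ (P.lossAt i) β) ^ s *
      ‖∇ (P.lossAt i) (est lam)‖ₑ ^ r < ∞ :=
  (le_iSup₂ (f := fun lam (_ : lam ∈ Λ) => (n : ℝ≥0∞)⁻¹ *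
    ∑ i, lipConst (fun β => ∇ (P.lossAt i) β) ^ s * ‖∇ (P.lossAt i) (est lam)‖ₑ ^ r)
      lam hm).trans_lt hB

theorem term_ne_top_of_moment {s r : ℕ} (hB : P.moment Λ est s r < ∞) {lam : ℝ≥0∞}
    (hm : lam ∈ Λ) (i : Fin n) : lipConst (fun β => ∇ (P.lossAt i) β) ^ s *
      ‖∇ (P.lossAt i) (est lam)‖ₑ ^ r ≠ ∞ := by
  have h := avg_lt_top_of_moment hB hm
  intro htop
  have hs : ∑ i, lipConst (fun β => ∇ (P.lossAt i) β) ^ s *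
      ‖∇ (P.lossAt i) (est lam)‖ₑ ^ r = ∞ :=
    ENNReal.sum_eq_top.2 ⟨i, Finset.mem_univ i, htop⟩
  rw [hs, ENNReal.mul_top (ENNReal.inv_ne_zero.2 (ENNReal.natCast_ne_top n))] at h
  exact lt_irrefl _ h

theorem avg_le_moment {s r : ℕ} (hB : P.moment Λ est s r < ∞) {lam : ℝ≥0∞} (hm : lam ∈ Λ) :
    1 / (n : ℝ) * ∑ i, P.lipGrad i ^ s * ‖∇ (P.lossAt i) (est lam)‖ ^ r ≤
      (P.moment Λ est s r).toReal := by
  have h := ENNReal.toReal_mono hB.ne (le_iSup₂ (f := fun lam (_ : lam ∈ Λ) => (n : ℝ≥0∞)⁻¹ *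
    ∑ i, lipConst (fun β => ∇ (P.lossAt i) β) ^ s * ‖∇ (P.lossAt i) (est lam)‖ₑ ^ r) lam hm)
  rw [ENNReal.toReal_mul, ENNReal.toReal_inv, ENNReal.toReal_natCast,
    ENNReal.toReal_sum fun i _ => term_ne_top_of_moment hB hm i] at h
  simp only [ENNReal.toReal_mul, ENNReal.toReal_pow, toReal_enorm] at h
  rw [one_div]
  exact h

/-- This makes the default `lipGrad = 0` harmless: a loss whose gradient has infinite Lipschitz
constant must be stationary at every `β(λ)`, so its Newton step is zero. -/
theorem gradient_eq_zero_of_lipConst_eq_top (hB : P.moment Λ est 1 1 < ∞) {lam : ℝ≥0∞}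
    (hm : lam ∈ Λ) {i : Fin n} (h : lipConst (fun β => ∇ (P.lossAt i) β) = ∞) :
    ∇ (P.lossAt i) (est lam) = 0 := by
  by_contra hne
  refine term_ne_top_of_moment hB hm i ?_
  rw [h, pow_one, pow_one, ENNReal.top_mul]
  simpa using hne

/-- Termwise `x² ≤ 1 + x³`. Finiteness of `B_{0,2}` is needed for its real value in `A` to be
meaningful. -/
theorem moment_zero_two_lt_top (hn : 0 < n) (h : P.moment Λ est 0 3 < ∞) :
    P.moment Λ est 0 2 < ∞ := by
  refine lt_of_le_of_lt ?_ (ENNReal.add_lt_top.2 ⟨ENNReal.one_lt_top, h⟩)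
  refine iSup₂_le fun lam hm => ?_
  refine le_trans ?_ (add_le_add le_rfl (le_iSup₂ (f := fun lam (_ : lam ∈ Λ) =>
    (n : ℝ≥0∞)⁻¹ * ∑ i, lipConst (fun β => ∇ (P.lossAt i) β) ^ 0 *
      ‖∇ (P.lossAt i) (est lam)‖ₑ ^ 3) lam hm))
  have h1 : (1 : ℝ≥0∞) = (n : ℝ≥0∞)⁻¹ * ∑ _i : Fin n, 1 := by
    rw [Finset.sum_const, Finset.card_univ, Fintype.card_fin, nsmul_eq_mul, mul_one,
      ENNReal.inv_mul_cancel (by exact_mod_cast hn.ne') (ENNReal.natCast_ne_top n)]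
  rw [h1, ← mul_add, ← Finset.sum_add_distrib]
  gcongr with i
  rw [pow_zero, one_mul, one_mul]
  rcases le_total ‖∇ (P.lossAt i) (est lam)‖ₑ 1 with hx | hx
  · exact (pow_le_one₀ zero_le hx).trans le_self_add
  · exact (pow_le_pow_right₀ hx (by norm_num)).trans le_add_self

/-! ### First-order expansion of the approximate cross-validation error -/

/-- `⟨∇ℓ_i, (∇² m(ℙ_{n,-i}, ·, lam'))⁻¹ ∇ℓ_i⟩` at `est lam`, and `0` for `lam' = ∞`. -/
noncomputable def newtonQuad (P : Problem d n Z) (est : ℝ≥0∞ → Vec d) (i : Fin n)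
    (lam lam' : ℝ≥0∞) : ℝ :=
  if lam' = ∞ then 0
  else inner ℝ (∇ (P.lossAt i) (est lam))
    ((hess (P.looObj i lam') (est lam)).inverse (∇ (P.lossAt i) (est lam)))

theorem acvest_sub_est {lam : ℝ≥0∞} (h : lam ≠ ∞) (i : Fin n) :
    P.acvest est i lam - est lam =
      (1 / n : ℝ) • (hess (P.looObj i lam) (est lam)).inverse (∇ (P.lossAt i) (est lam)) := by
  rw [acvest, if_neg h, add_sub_cancel_left, map_smul]

namespace Regular

variable (R : P.Regular Λ est closs creg cobj lamreg Closs2 Creg2 Closs3 Creg3)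

include R

theorem norm_acvest_sub_est_le {lam : ℝ≥0∞} (hm : lam ∈ Λ) (h : lam ≠ ∞) (i : Fin n) :
    ‖P.acvest est i lam - est lam‖ ≤ ‖∇ (P.lossAt i) (est lam)‖ / (n * cobj) := by
  have hn := R.n_pos
  have hH := R.cobj_le_hess hm h i (est lam)
  have := norm_le_of_map_eq R.cobj_pos hH (inverse_spec R.cobj_pos hH (∇ (P.lossAt i) (est lam)))
  rw [acvest_sub_est h, norm_smul, Real.norm_eq_abs, abs_of_pos (by positivity)]
  calc _ ≤ 1 / (n : ℝ) * (‖∇ (P.lossAt i) (est lam)‖ / cobj) := by gcongr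
    _ = _ := by field_simp

theorem abs_lossAt_acvest_sub_le (hB : P.moment Λ est 1 1 < ∞) {lam : ℝ≥0∞} (hm : lam ∈ Λ)
    (i : Fin n) :
    |P.lossAt i (P.acvest est i lam) - P.lossAt i (est lam) - 1 / n * P.newtonQuad est i lam lam| ≤
      P.lipGrad i ^ 1 * ‖∇ (P.lossAt i) (est lam)‖ ^ 2 / (2 * n ^ 2 * cobj ^ 2) := by
  have hn := R.n_pos
  have hc := R.cobj_pos
  have hL := P.lipGrad_nonneg i
  by_cases h : lam = ∞
  · subst h
    simp only [acvest, newtonQuad, if_true, sub_self, mul_zero, abs_zero]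
    positivity
  by_cases htop : lipConst (fun β => ∇ (P.lossAt i) β) = ∞
  · have hg := gradient_eq_zero_of_lipConst_eq_top hB hm htop
    simp [acvest, newtonQuad, h, hg]
  have ht := abs_sub_sub_inner_gradient_le (R.loss i).1 hL (ENNReal.ofReal_toReal htop).ge
    (est lam) (P.acvest est i lam)
  have hq : inner ℝ (∇ (P.lossAt i) (est lam)) (P.acvest est i lam - est lam) =
      1 / n * P.newtonQuad est i lam lam := by
    rw [acvest_sub_est h, real_inner_smul_right, newtonQuad, if_neg h]
  rw [hq] at ht
  refine ht.trans ?_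
  calc _ ≤ P.lipGrad i / 2 * (‖∇ (P.lossAt i) (est lam)‖ / (n * cobj)) ^ 2 := by
        gcongr
        exact R.norm_acvest_sub_est_le hm h i
    _ = _ := by field_simp

theorem abs_ACV_sub_le (hB : P.moment Λ est 1 1 < ∞) (hB2 : P.moment Λ est 1 2 < ∞)
    {lam : ℝ≥0∞} (hm : lam ∈ Λ) :
    |P.ACV est lam - P.empLoss (est lam) - 1 / n * (1 / n * ∑ i, P.newtonQuad est i lam lam)| ≤
      (P.moment Λ est 1 2).toReal / (2 * n ^ 2 * cobj ^ 2) := by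
  have hn := R.n_pos
  have hc := R.cobj_pos
  have e : P.ACV est lam - P.empLoss (est lam) -
      1 / n * (1 / n * ∑ i, P.newtonQuad est i lam lam) =
      1 / n * ∑ i, (P.lossAt i (P.acvest est i lam) - P.lossAt i (est lam) -
        1 / n * P.newtonQuad est i lam lam) := by
    rw [ACV, empLoss, Finset.sum_sub_distrib, Finset.sum_sub_distrib, ← Finset.mul_sum]
    ring
  rw [e, abs_mul, abs_of_pos (by positivity)]
  calc _ ≤ 1 / (n : ℝ) * ∑ i, P.lipGrad i ^ 1 * ‖∇ (P.lossAt i) (est lam)‖ ^ 2 /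
        (2 * n ^ 2 * cobj ^ 2) := by
        gcongr
        refine (Finset.abs_sum_le_sum_abs _ _).trans (Finset.sum_le_sum fun i _ => ?_)
        exact R.abs_lossAt_acvest_sub_le hB hm i
    _ = (1 / (n : ℝ) * ∑ i, P.lipGrad i ^ 1 * ‖∇ (P.lossAt i) (est lam)‖ ^ 2) /
        (2 * n ^ 2 * cobj ^ 2) := by rw [← Finset.sum_div]; ring
    _ ≤ _ := by
        gcongr
        exact avg_le_moment hB2 hm

/-! ### Variation of the first-order term along the regularization path -/

/-- The Hessian's base point moves while level and gradient stay fixed. The Lipschitz constant is at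
most `2 κ₂ D_t`, with `D_t` the curvature bound at level `t`, and coercivity `D_t` at `β(t)` cancels
`D_t`; at `β(λ)` only `closs` is used. -/
theorem newtonQuad_sub_le_hess {lam : ℝ≥0∞} {t : ℝ≥0} (hm : lam ∈ Λ) (hm' : (t : ℝ≥0∞) ∈ Λ)
    (i : Fin n) :
    inner ℝ (∇ (P.lossAt i) (est t)) ((hess (P.looObj i t) (est t)).inverse
        (∇ (P.lossAt i) (est t))) -
      inner ℝ (∇ (P.lossAt i) (est t)) ((hess (P.looObj i t) (est lam)).inverse
        (∇ (P.lossAt i) (est t))) ≤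
      kappa 2 Closs3 Creg3 closs creg lamreg / (closs / 2) *
        ‖∇ (P.lossAt i) (est t)‖ ^ 2 * ‖est lam - est t‖ := by
  have hl := R.closs_pos
  have hfin : (t : ℝ≥0∞) ≠ ∞ := ENNReal.coe_ne_top
  obtain ⟨h3, h3', hlip⟩ := R.lipschitzHessian
  have hD : 0 < curvBound closs creg lamreg t := hl.trans_le (le_curvBound R.creg_pos.le)
  have hk := le_kappa_mul (p := 2) (lamreg := lamreg) h3 h3' hl R.creg_pos t
  have hH : ‖hess (P.looObj i t) (est lam) - hess (P.looObj i t) (est t)‖ ≤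
      (Closs3 + t * Creg3) * ‖est lam - est t‖ := by
    have := lipConst_le_iff (hlip i t hm') (penalized_nonneg h3 h3') (est lam) (est t)
    rwa [penalized, if_neg hfin, ENNReal.coe_toReal] at this
  refine (inner_inverse_sub_le_of_lipschitz hD hl (R.hess_looObj_isSymmetric hm hm' i)
    (R.curvBound_le_hess hm' hm' le_rfl i) (R.closs_le_hess hm hm' hfin i) hH _).trans ?_
  set κ := kappa 2 Closs3 Creg3 closs creg lamreg
  set D := curvBound closs creg lamreg t
  simp only [Nat.factorial_two, Nat.cast_ofNat] at hk
  calc _ ≤ (2 * κ * D) * ‖est lam - est t‖ * ‖∇ (P.lossAt i) (est t)‖ ^ 2 / (D * closs) := by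
        gcongr
    _ = _ := by field_simp

theorem newtonQuad_sub_le_gradient (hB : P.moment Λ est 1 1 < ∞) {lam : ℝ≥0∞} {t : ℝ≥0}
    (hm : lam ∈ Λ) (hm' : (t : ℝ≥0∞) ∈ Λ) (i : Fin n) :
    inner ℝ (∇ (P.lossAt i) (est t)) ((hess (P.looObj i t) (est lam)).inverse
        (∇ (P.lossAt i) (est t))) -
      inner ℝ (∇ (P.lossAt i) (est lam)) ((hess (P.looObj i t) (est lam)).inverse
        (∇ (P.lossAt i) (est lam))) ≤
      (P.lipGrad i ^ 1 * ‖∇ (P.lossAt i) (est lam)‖ ^ 1 +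
        P.lipGrad i ^ 1 * ‖∇ (P.lossAt i) (est t)‖ ^ 1) * ‖est lam - est t‖ / closs := by
  have hl := R.closs_pos
  have hL := P.lipGrad_nonneg i
  by_cases htop : lipConst (fun β => ∇ (P.lossAt i) β) = ∞
  · rw [gradient_eq_zero_of_lipConst_eq_top hB hm htop,
      gradient_eq_zero_of_lipConst_eq_top hB hm' htop]
    simp
  refine inner_inverse_sub_inner_inverse_le hl (R.hess_looObj_isSymmetric hm hm' i)
    (R.closs_le_hess hm hm' ENNReal.coe_ne_top i)
    (lipConst_le_iff (ENNReal.ofReal_toReal htop).ge hL (est t) (est lam)) ?_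
  change P.lipGrad i * _ * _ + P.lipGrad i * _ * _ ≤ _
  rw [norm_sub_rev (est t)]
  apply le_of_eq
  ring

/-- Only the level moves, from `t` to `lam`, at the base point `β(λ)`. The Hessian increases by at
most `(lam - t) * Creg2`, a one-sided bound that the perturbation lemma accepts, and
`sub_le_mul_norm` converts `lam - t` into distance. -/
theorem newtonQuad_sub_le_regularization {lam : ℝ≥0∞} {t : ℝ≥0} (hm : lam ∈ Λ)
    (hm' : (t : ℝ≥0∞) ∈ Λ) (hlt : t < lam) (i : Fin n) :
    inner ℝ (∇ (P.lossAt i) (est lam)) ((hess (P.looObj i t) (est lam)).inverse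
        (∇ (P.lossAt i) (est lam))) - P.newtonQuad est i lam lam ≤
      Creg2 * kappa 1 Closs2 Creg2 closs creg lamreg ^ 2 / (‖∇ P.reg (est 0)‖ * cobj) *
        ‖∇ (P.lossAt i) (est lam)‖ ^ 2 * ‖est lam - est t‖ := by
  have hR2 := R.boundedHessian.2.1
  have hDt : 0 < curvBound closs creg lamreg t := R.closs_pos.trans_le (le_curvBound R.creg_pos.le)
  have hc := R.cobj_pos
  have hp := R.grad_pos
  set κ := kappa 1 Closs2 Creg2 closs creg lamreg
  by_cases h : lam = ∞
  · subst h
    rw [newtonQuad, if_pos rfl, sub_zero]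
    refine (inner_inverse_le hDt (R.curvBound_le_hess hm hm' le_top i) _).trans ?_
    have h1 := R.one_le_mul_norm_of_top hm hm'
    rw [div_le_iff₀ hDt]
    calc _ = 1 * ‖∇ (P.lossAt i) (est ∞)‖ ^ 2 := (one_mul _).symm
      _ ≤ (Creg2 * κ ^ 2 / (‖∇ P.reg (est 0)‖ * cobj) * curvBound closs creg lamreg t *
          ‖est ∞ - est t‖) * ‖∇ (P.lossAt i) (est ∞)‖ ^ 2 := by gcongr
      _ = _ := by ring
  · lift lam to ℝ≥0 using h
    have hts : t ≤ lam := ENNReal.coe_le_coe.1 hlt.le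
    have hDs : 0 < curvBound closs creg lamreg lam :=
      R.closs_pos.trans_le (le_curvBound R.creg_pos.le)
    have hst : (0 : ℝ) ≤ lam - t := sub_nonneg.2 (by exact_mod_cast hts)
    rw [newtonQuad, if_neg ENNReal.coe_ne_top]
    refine (inner_inverse_sub_le_of_perturbation hDt hDs (C := (lam - t) * Creg2) (by positivity)
      (R.hess_looObj_isSymmetric hm hm i) (R.curvBound_le_hess hm hm' hlt.le i)
      (R.curvBound_le_hess hm hm le_rfl i) (fun v => ?_) _).trans ?_
    · have hb := ((ContinuousLinearMap.le_def _ _).1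
        (R.boundedHessian.2.2.2 lam hm)).inner_nonneg_left v
      simp only [sub_apply, smul_apply, ContinuousLinearMap.id_apply, inner_sub_left,
        real_inner_smul_left, real_inner_self_eq_norm_sq] at hb
      rw [R.hess_looObj ENNReal.coe_ne_top, R.hess_looObj ENNReal.coe_ne_top]
      simp only [add_apply, smul_apply, inner_add_left, real_inner_smul_left, ENNReal.coe_toReal]
      nlinarith [mul_nonneg hst hb]
    · rw [div_le_iff₀ (by positivity)]
      have h1 := R.sub_le_mul_norm hm hm' hts
      calc _ = (lam - t : ℝ) * (Creg2 * ‖∇ (P.lossAt i) (est lam)‖ ^ 2) := by ring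
        _ ≤ (κ ^ 2 / (‖∇ P.reg (est 0)‖ * cobj) *
            (curvBound closs creg lamreg lam * curvBound closs creg lamreg t) *
            ‖est lam - est t‖) * (Creg2 * ‖∇ (P.lossAt i) (est lam)‖ ^ 2) := by gcongr
        _ = _ := by ring

theorem avg_newtonQuad_sub_le (hB : P.moment Λ est 1 1 < ∞) (hB2 : P.moment Λ est 0 2 < ∞)
    {lam lam' : ℝ≥0∞} (hm : lam ∈ Λ) (hm' : lam' ∈ Λ) (hlt : lam' < lam) :
    1 / (n : ℝ) * ∑ i, P.newtonQuad est i lam' lam' - 1 / n * ∑ i, P.newtonQuad est i lam lam ≤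
      (((P.moment Λ est 1 1).toReal +
        (P.moment Λ est 0 2).toReal * kappa 2 Closs3 Creg3 closs creg lamreg) / (closs / 2) +
      (P.moment Λ est 0 2).toReal * Creg2 * kappa 1 Closs2 Creg2 closs creg lamreg ^ 2 /
        (‖∇ P.reg (est 0)‖ * cobj)) * ‖est lam - est lam'‖ := by
  lift lam' to ℝ≥0 using hlt.ne_top with t
  have hl := R.closs_pos
  have hc := R.cobj_pos
  have hp := R.grad_pos
  have hn := R.n_pos
  have hR2 := R.boundedHessian.2.1
  have hκ : 0 ≤ kappa 2 Closs3 Creg3 closs creg lamreg :=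
    kappa_nonneg R.lipschitzHessian.1 R.lipschitzHessian.2.1 hl R.creg_pos
  set κ₁ := kappa 1 Closs2 Creg2 closs creg lamreg
  set κ₂ := kappa 2 Closs3 Creg3 closs creg lamreg
  set Δ := ‖est lam - est t‖
  set X := Creg2 * κ₁ ^ 2 / (‖∇ P.reg (est 0)‖ * cobj) with hX
  have hX0 : 0 ≤ X := by positivity
  have hΔ : 0 ≤ Δ := norm_nonneg _
  have m1 := avg_le_moment hB hm
  have m1' := avg_le_moment hB hm'
  have m2 := avg_le_moment hB2 hm
  have m2' := avg_le_moment hB2 hm'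
  simp only [pow_zero, one_mul] at m2 m2'
  have key : ∀ i, P.newtonQuad est i t t - P.newtonQuad est i lam lam ≤
      κ₂ / (closs / 2) * Δ * ‖∇ (P.lossAt i) (est t)‖ ^ 2 +
      (Δ / closs * (P.lipGrad i ^ 1 * ‖∇ (P.lossAt i) (est lam)‖ ^ 1) +
        Δ / closs * (P.lipGrad i ^ 1 * ‖∇ (P.lossAt i) (est t)‖ ^ 1)) +
      X * Δ * ‖∇ (P.lossAt i) (est lam)‖ ^ 2 := by
    intro i
    have h1 := R.newtonQuad_sub_le_hess hm hm' i
    have h2 := R.newtonQuad_sub_le_gradient hB hm hm' i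
    have h3 := R.newtonQuad_sub_le_regularization hm hm' hlt i
    have e : P.newtonQuad est i t t = inner ℝ (∇ (P.lossAt i) (est t))
      ((hess (P.looObj i t) (est t)).inverse (∇ (P.lossAt i) (est t))) := by
      rw [newtonQuad, if_neg ENNReal.coe_ne_top]
    rw [e]
    refine (add_le_add (add_le_add h1 h2) h3).trans' (by linarith) |>.trans_eq ?_
    ring
  have hsum := Finset.sum_le_sum fun i (_ : i ∈ Finset.univ) => key i
  simp only [Finset.sum_sub_distrib, Finset.sum_add_distrib, ← Finset.mul_sum] at hsum
  have hsum' := mul_le_mul_of_nonneg_left hsum (by positivity : 0 ≤ 1 / (n : ℝ))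
  have a1 := mul_le_mul_of_nonneg_left m2' (by positivity : 0 ≤ κ₂ / (closs / 2) * Δ)
  have a2 := mul_le_mul_of_nonneg_left m1 (by positivity : 0 ≤ Δ / closs)
  have a3 := mul_le_mul_of_nonneg_left m1' (by positivity : 0 ≤ Δ / closs)
  have a4 := mul_le_mul_of_nonneg_left m2 (by positivity : 0 ≤ X * Δ)
  have e : (((P.moment Λ est 1 1).toReal + (P.moment Λ est 0 2).toReal * κ₂) / (closs / 2) +
      (P.moment Λ est 0 2).toReal * Creg2 * κ₁ ^ 2 / (‖∇ P.reg (est 0)‖ * cobj)) * Δ =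
      κ₂ / (closs / 2) * Δ * (P.moment Λ est 0 2).toReal +
      (Δ / closs * (P.moment Λ est 1 1).toReal + Δ / closs * (P.moment Λ est 1 1).toReal) +
      X * Δ * (P.moment Λ est 0 2).toReal := by
    rw [hX]; field_simp; ring
  rw [e]
  linarith

/-! ### Approximate versus exact cross-validation -/

/-- At `∞` strong convexity is lost, so uniqueness comes from the Hessian. Minimizers of the convex
`π` form a convex set, the gradient vanishes on the segment from `β` to `b`, and hence the Hessian
at `β` annihilates `b - β`. The curvature assumption at `∞` forbids this unless `b = β`. -/
theorem est_top_eq {b : Vec d} (hm : ∞ ∈ Λ) (hb : IsMinOn P.reg Set.univ b) : b = est ∞ := by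
  have hest := R.isEstimator ∞ hm
  rw [empObj_top] at hest
  set β := est ∞
  have i : Fin n := ⟨0, Nat.zero_lt_two.trans_le R.two_le⟩
  have hmin : ∀ s ∈ Set.Icc (0 : ℝ) 1, ∇ P.reg (β + s • (b - β)) = 0 := by
    intro s hs
    refine gradient_eq_zero_of_isMinOn fun y _ => ?_
    set x := β + s • (b - β) with hx
    have c1 := (R.strongMono_reg hm).add_quadratic_le R.reg.1 β x
    have c2 := (R.strongMono_reg hm).add_quadratic_le R.reg.1 b x
    have hbx : P.reg b ≤ P.reg β := hb (Set.mem_univ β)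
    have hβy : P.reg β ≤ P.reg y := hest (Set.mem_univ y)
    have e1 : β - x = (-s) • (b - β) := by rw [hx]; module
    have e2 : b - x = (1 - s) • (b - β) := by rw [hx]; module
    rw [e1, real_inner_smul_right] at c1
    rw [e2, real_inner_smul_right] at c2
    simp only [zero_div, zero_mul, add_zero] at c1 c2
    have d1 := mul_le_mul_of_nonneg_left c1 (sub_nonneg.2 hs.2)
    have d2 := mul_le_mul_of_nonneg_left c2 hs.1
    have d3 := mul_le_mul_of_nonneg_left hbx hs.1
    change P.reg x ≤ P.reg y
    linarith
  have hd : HasDerivAt (fun s : ℝ => ∇ P.reg (β + s • (b - β))) (hess P.reg β (b - β)) 0 := by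
    have := hasDerivAt_comp_segment (f := fun y => ∇ P.reg y) (x := β) (v := b - β) (t := 0)
      (R.reg.2 _)
    simpa only [zero_smul, add_zero, hess] using this
  have hz : hess P.reg β (b - β) = 0 := by
    -- The gradient is known to vanish only for `s ∈ [0, 1]`, so the derivative at `0` is identified
    -- from one side.
    have hu : UniqueDiffWithinAt ℝ (Set.Icc (0 : ℝ) 1) 0 :=
      uniqueDiffOn_Icc zero_lt_one 0 (Set.left_mem_Icc.2 zero_le_one)
    have h1 := hd.hasDerivWithinAt (s := Set.Icc 0 1)
    have h2 : HasDerivWithinAt (fun s : ℝ => ∇ P.reg (β + s • (b - β))) 0 (Set.Icc 0 1) 0 :=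
      (hasDerivWithinAt_const (0 : ℝ) (Set.Icc 0 1) (0 : Vec d)).congr hmin
        (hmin 0 (Set.left_mem_Icc.2 zero_le_one))
    exact hu.eq_deriv _ h1 h2
  have hc := R.le_hess_looObj hm hm i (b - β)
  rw [looObj_top, penalized, if_pos rfl, if_pos le_top, hz, inner_zero_left] at hc
  have : ‖b - β‖ ^ 2 ≤ 0 := nonpos_of_mul_nonpos_right hc R.creg_pos
  have h0 : ‖b - β‖ ^ 2 = 0 := le_antisymm this (sq_nonneg _)
  exact sub_eq_zero.1 (by simpa using h0)

/-- After one Newton step the leave-one-out gradient is only the second-order Taylor remainder.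
Strong monotonicity turns this small gradient into a small distance to the minimizer. -/
theorem norm_acvest_sub_le {b : Vec d} {t : ℝ≥0} (hm : (t : ℝ≥0∞) ∈ Λ) (i : Fin n)
    (hb : IsMinOn (P.looObj i t) Set.univ b) :
    ‖P.acvest est i t - b‖ ≤ kappa 2 Closs3 Creg3 closs creg lamreg *
      ‖∇ (P.lossAt i) (est t)‖ ^ 2 / (n ^ 2 * cobj ^ 2) := by
  have hl := R.closs_pos
  have hc := R.cobj_pos
  have hn := R.n_pos
  have hfin : (t : ℝ≥0∞) ≠ ∞ := ENNReal.coe_ne_top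
  obtain ⟨h3, h3', hlip⟩ := R.lipschitzHessian
  have hD : 0 < curvBound closs creg lamreg t := hl.trans_le (le_curvBound R.creg_pos.le)
  have hk := le_kappa_mul (p := 2) (lamreg := lamreg) h3 h3' hl R.creg_pos t
  simp only [Nat.factorial_two, Nat.cast_ofNat] at hk
  set κ := kappa 2 Closs3 Creg3 closs creg lamreg
  set D := curvBound closs creg lamreg t
  set g := ∇ (P.lossAt i) (est t) with hg
  have hHD := R.curvBound_le_hess hm hm le_rfl i
  have hx := inverse_spec hD hHD g
  have hnD := norm_le_of_map_eq hD hHD hx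
  have hnc := norm_le_of_map_eq hc (R.cobj_le_hess hm hfin i _) hx
  have hsub := acvest_sub_est (P := P) (est := est) hfin i
  have hL : 0 ≤ Closs3 + t * Creg3 := by positivity
  have htay := norm_gradient_sub_sub_hess_le (R.twice_looObj i t).2 (penalized_nonneg h3 h3')
    (hlip i t hm) (est t) (P.acvest est i t)
  -- The gradient at `β(t)` is `-g / n` and the Hessian maps the Newton step to `g / n`, so the two
  -- cancel.
  rw [R.gradient_looObj_est hm hfin, hsub, map_smul, hx, sub_neg_eq_add, add_sub_cancel_right,
    norm_smul, Real.norm_eq_abs, abs_of_pos (by positivity), penalized, if_neg hfin,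
    ENNReal.coe_toReal] at htay
  have hmono := (R.strongMono_looObj hm hfin i).mul_norm_le (P.acvest est i t) b
  simp only [gradient_eq_zero_of_isMinOn hb, sub_zero] at hmono
  -- One factor uses the curvature `D`, which cancels against `2 κ D`; the other uses `cobj`.
  have hsq : ‖(hess (P.looObj i t) (est t)).inverse g‖ ^ 2 ≤ ‖g‖ / D * (‖g‖ / cobj) := by
    rw [sq]; gcongr
  rw [le_div_iff₀ (by positivity)]
  have h1 := hmono.trans htay
  have h2 : (Closs3 + t * Creg3) / 2 * (1 / n * ‖(hess (P.looObj i t) (est t)).inverse g‖) ^ 2 ≤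
      κ * ‖g‖ ^ 2 / (n ^ 2 * cobj) := by
    calc _ = (Closs3 + t * Creg3) / 2 / n ^ 2 *
          ‖(hess (P.looObj i t) (est t)).inverse g‖ ^ 2 := by field_simp
      _ ≤ (2 * κ * D) / 2 / n ^ 2 * (‖g‖ / D * (‖g‖ / cobj)) := by
        have := hL.trans hk
        gcongr
      _ = _ := by field_simp
  have h4 := h1.trans h2
  rw [le_div_iff₀ (by positivity)] at h4
  linarith

theorem abs_lossAt_acvest_sub_cvest_le (hB : P.moment Λ est 1 1 < ∞) {b : Vec d} {t : ℝ≥0}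
    (hm : (t : ℝ≥0∞) ∈ Λ) (i : Fin n) (hb : IsMinOn (P.looObj i t) Set.univ b) :
    |P.lossAt i (P.acvest est i t) - P.lossAt i b| ≤
      1 / n ^ 2 * (kappa 2 Closs3 Creg3 closs creg lamreg *
          (P.lipGrad i ^ 0 * ‖∇ (P.lossAt i) (est t)‖ ^ 3 / cobj ^ 2) +
        kappa 2 Closs3 Creg3 closs creg lamreg / n *
          (P.lipGrad i ^ 1 * ‖∇ (P.lossAt i) (est t)‖ ^ 3 / cobj ^ 3) +
        kappa 2 Closs3 Creg3 closs creg lamreg ^ 2 / n ^ 2 *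
          (P.lipGrad i ^ 1 * ‖∇ (P.lossAt i) (est t)‖ ^ 4 / (2 * cobj ^ 4))) := by
  have hc := R.cobj_pos
  have hn := R.n_pos
  have hL := P.lipGrad_nonneg i
  have hκ : 0 ≤ kappa 2 Closs3 Creg3 closs creg lamreg :=
    kappa_nonneg R.lipschitzHessian.1 R.lipschitzHessian.2.1 R.closs_pos R.creg_pos
  have he := R.norm_acvest_sub_le hm i hb
  set κ := kappa 2 Closs3 Creg3 closs creg lamreg
  set g := ∇ (P.lossAt i) (est t) with hg
  set a := P.acvest est i t
  by_cases htop : lipConst (fun β => ∇ (P.lossAt i) β) = ∞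
  · have hg0 : g = 0 := gradient_eq_zero_of_lipConst_eq_top hB hm htop
    rw [hg0] at he
    have hab : a = b := by
      rw [← sub_eq_zero, ← norm_le_zero_iff]
      simpa using he
    rw [hab, sub_self, abs_zero]
    positivity
  have hlip := (ENNReal.ofReal_toReal htop).ge
  have ht := abs_sub_sub_inner_gradient_le (R.loss i).1 hL hlip a b
  have hd := R.norm_acvest_sub_est_le hm ENNReal.coe_ne_top i
  -- The loss is expanded at the approximate estimator, so its gradient there is first compared with
  -- `g` over one Newton step. The extra term produces the `B_{1,3}` contribution.
  have hga : ‖∇ (P.lossAt i) a‖ ≤ ‖g‖ + P.lipGrad i * (‖g‖ / (n * cobj)) := by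
    have h1 := lipConst_le_iff hlip hL a (est t)
    have h2 := norm_le_norm_add_norm_sub' (∇ (P.lossAt i) a) g
    calc _ ≤ ‖g‖ + ‖∇ (P.lossAt i) a - g‖ := h2
      _ ≤ ‖g‖ + P.lipGrad i * ‖a - est t‖ := by gcongr; exact h1
      _ ≤ _ := by gcongr
  rw [norm_sub_rev] at ht
  have hin := abs_real_inner_le_norm (∇ (P.lossAt i) a) (b - a)
  rw [norm_sub_rev] at hin
  have habs : |P.lossAt i a - P.lossAt i b| ≤
      ‖∇ (P.lossAt i) a‖ * ‖a - b‖ + P.lipGrad i / 2 * ‖a - b‖ ^ 2 := by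
    rw [abs_sub_comm]
    have := abs_add_le (P.lossAt i b - P.lossAt i a - inner ℝ (∇ (P.lossAt i) a) (b - a))
      (inner ℝ (∇ (P.lossAt i) a) (b - a))
    rw [sub_add_cancel] at this
    change |_| ≤ P.lipGrad i / 2 * _ at ht
    linarith
  refine habs.trans ?_
  calc _ ≤ (‖g‖ + P.lipGrad i * (‖g‖ / (n * cobj))) * (κ * ‖g‖ ^ 2 / (n ^ 2 * cobj ^ 2)) +
        P.lipGrad i / 2 * (κ * ‖g‖ ^ 2 / (n ^ 2 * cobj ^ 2)) ^ 2 := by gcongr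
    _ = _ := by field_simp

theorem abs_ACV_sub_CV_le (hB03 : P.moment Λ est 0 3 < ∞) (hB11 : P.moment Λ est 1 1 < ∞)
    (hB13 : P.moment Λ est 1 3 < ∞) (hB14 : P.moment Λ est 1 4 < ∞)
    {cvest : Fin n → ℝ≥0∞ → Vec d} (hcv : P.IsCVEstimator Λ cvest) {lam : ℝ≥0∞} (hm : lam ∈ Λ) :
    |P.ACV est lam - P.CV cvest lam| ≤
      1 / n ^ 2 * (kappa 2 Closs3 Creg3 closs creg lamreg *
          ((P.moment Λ est 0 3).toReal / cobj ^ 2) +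
        kappa 2 Closs3 Creg3 closs creg lamreg / n * ((P.moment Λ est 1 3).toReal / cobj ^ 3) +
        kappa 2 Closs3 Creg3 closs creg lamreg ^ 2 / n ^ 2 *
          ((P.moment Λ est 1 4).toReal / (2 * cobj ^ 4))) := by
  have hc := R.cobj_pos
  have hn := R.n_pos
  have hκ : 0 ≤ kappa 2 Closs3 Creg3 closs creg lamreg :=
    kappa_nonneg R.lipschitzHessian.1 R.lipschitzHessian.2.1 R.closs_pos R.creg_pos
  by_cases h : lam = ∞
  · subst h
    have : P.ACV est ∞ = P.CV cvest ∞ := by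
      rw [ACV, CV]
      refine congrArg _ (Finset.sum_congr rfl fun i _ => ?_)
      have hb := hcv i ∞ hm
      rw [looObj_top] at hb
      rw [acvest, if_pos rfl, R.est_top_eq hm hb]
    rw [this, sub_self, abs_zero]
    positivity
  lift lam to ℝ≥0 using h with t
  have key := Finset.sum_le_sum fun i (_ : i ∈ Finset.univ) =>
    R.abs_lossAt_acvest_sub_cvest_le hB11 hm i (hcv i t hm)
  have m1 := avg_le_moment hB03 hm
  have m2 := avg_le_moment hB13 hm
  have m3 := avg_le_moment hB14 hm
  set κ := kappa 2 Closs3 Creg3 closs creg lamreg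
  rw [ACV, CV, ← mul_sub, ← Finset.sum_sub_distrib, abs_mul, abs_of_pos (by positivity)]
  refine (mul_le_mul_of_nonneg_left ((Finset.abs_sum_le_sum_abs _ _).trans key)
    (by positivity)).trans ?_
  calc _ = 1 / n ^ 2 * (κ * ((1 / (n : ℝ) * ∑ i, P.lipGrad i ^ 0 *
            ‖∇ (P.lossAt i) (est t)‖ ^ 3) / cobj ^ 2) +
          κ / n * ((1 / (n : ℝ) * ∑ i, P.lipGrad i ^ 1 *
            ‖∇ (P.lossAt i) (est t)‖ ^ 3) / cobj ^ 3) +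
          κ ^ 2 / n ^ 2 * ((1 / (n : ℝ) * ∑ i, P.lipGrad i ^ 1 *
            ‖∇ (P.lossAt i) (est t)‖ ^ 4) / (2 * cobj ^ 4))) := by
        rw [← Finset.mul_sum, Finset.sum_add_distrib, Finset.sum_add_distrib, ← Finset.mul_sum,
          ← Finset.mul_sum, ← Finset.mul_sum, ← Finset.sum_div, ← Finset.sum_div,
          ← Finset.sum_div]
        ring
    _ ≤ _ := by gcongr

end Regular

/-- With a single datapoint the leave-one-out loss vanishes, which leaves no curvature at
`lam = 0`. -/
theorem two_le_of_curvature (hn : 0 < n) (h0 : 0 ∈ Λ)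
    (h : P.Curvature Λ est closs creg cobj lamreg) {v : Vec d} (hv : 0 < ‖v‖) : 2 ≤ n := by
  by_contra hlt
  obtain rfl : n = 1 := by omega
  have hg := h.2.2.2.1 0 0 h0
  have hz : P.looObj 0 0 = fun _ => 0 := by
    rw [looObj_eq ENNReal.zero_ne_top]
    funext β
    simp [looLoss, Finset.filter_ne']
  simp only [penalized, if_neg ENNReal.zero_ne_top, mul_zero, add_zero, hz] at hg
  have := hg.strongMono (differentiable_const 0) v 0
  simp only [sub_zero, gradient_fun_const, sub_self, inner_zero_right] at this
  have h3 := h.2.2.1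
  have : 0 < cobj * ‖v‖ ^ 2 := by positivity
  linarith

end Problem

end ApproxCV

/-! ### The selection bounds. -/

theorem mainTheorem5 {d n : ℕ} {Z : Type*} (hn : 0 < n)
    (P : ApproxCV.Problem d n Z)
    (hloss : ∀ i, ApproxCV.TwiceDifferentiable (P.lossAt i))
    (hreg : ApproxCV.TwiceDifferentiable P.reg)
    (Λ : Set ℝ≥0∞) (h0 : 0 ∈ Λ)
    (est : ℝ≥0∞ → ApproxCV.Vec d) (hest : P.IsEstimator Λ est)
    (cvest : Fin n → ℝ≥0∞ → ApproxCV.Vec d) (hcvest : P.IsCVEstimator Λ cvest)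
    (closs creg cobj : ℝ) (lamreg : ℝ≥0)
    (hcurv : P.Curvature Λ est closs creg cobj lamreg)
    (Closs3 Creg3 : ℝ) (hlip : P.LipschitzHessian Λ Closs3 Creg3)
    (Closs2 Creg2 : ℝ) (hbdd : P.BoundedHessian Λ est Closs2 Creg2)
    (hB : ∀ sr ∈ ({(0, 3), (1, 1), (1, 2), (1, 3), (1, 4)} : Set (ℕ × ℕ)),
      P.moment Λ est sr.1 sr.2 < ∞)
    (hgrad : 0 < ‖∇ P.reg (est 0)‖) :
    let B : ℕ → ℕ → ℝ := fun s r => (P.moment Λ est s r).toReal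
    let κ₁ : ℝ := ApproxCV.kappa 1 Closs2 Creg2 closs creg lamreg
    let κ₂ : ℝ := ApproxCV.kappa 2 Closs3 Creg3 closs creg lamreg
    let A : ℝ := (B 1 1 + B 0 2 * κ₂) / (closs / 2) +
      B 0 2 * Creg2 * κ₁ ^ 2 / (‖∇ P.reg (est 0)‖ * cobj)
    let A' : ℝ := B 1 2 / cobj ^ 2
    let A'' : ℝ := 2 * (κ₂ * (B 0 3 / cobj ^ 2) + κ₂ / n * (B 1 3 / cobj ^ 3) +
      κ₂ ^ 2 / n ^ 2 * (B 1 4 / (2 * cobj ^ 4)))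
    (∀ lam ∈ Λ, ∀ lam' ∈ Λ, lam' < lam →
      |‖est lam - est lam'‖ - 1 / n * (A / cobj)| ^ 2 ≤
        (A ^ 2 + 2 * cobj * A') / (n ^ 2 * cobj ^ 2) +
          2 * (P.ACV est lam - P.ACV est lam') / cobj) ∧
    (∀ lamACV ∈ Λ, ∀ lamCV ∈ Λ,
      IsMinOn (P.ACV est) Λ lamACV → IsMinOn (P.CV cvest) Λ lamCV →
        |‖est lamACV - est lamCV‖ - 1 / n * (A / cobj)| ^ 2 ≤
            (A ^ 2 + 2 * cobj * A' + 2 * cobj * A'') / (n ^ 2 * cobj ^ 2) ∧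
          ‖est lamACV - est lamCV‖ ≤
            1 / n * ((A + √(A ^ 2 + 2 * cobj * A' + 2 * cobj * A'')) / cobj)) := by
  intro B κ₁ κ₂ A A' A''
  have R : P.Regular Λ est closs creg cobj lamreg Closs2 Creg2 Closs3 Creg3 :=
    ⟨ApproxCV.Problem.two_le_of_curvature hn h0 hcurv hgrad, hloss, hreg, h0, hest, hcurv, hlip,
      hbdd, hgrad⟩
  have hB03 := hB (0, 3) (by simp)
  have hB11 := hB (1, 1) (by simp)
  have hB12 := hB (1, 2) (by simp)
  have hB13 := hB (1, 3) (by simp)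
  have hB14 := hB (1, 4) (by simp)
  have hB02 := ApproxCV.Problem.moment_zero_two_lt_top hn hB03
  have hc := R.cobj_pos
  have hn' := R.n_pos
  have hκ₂ : 0 ≤ κ₂ :=
    ApproxCV.kappa_nonneg hlip.1 hlip.2.1 R.closs_pos R.creg_pos
  have hBn : ∀ s r, 0 ≤ B s r := fun s r => ENNReal.toReal_nonneg
  have hA' : 0 ≤ A' := div_nonneg (hBn 1 2) (by positivity)
  have hA'' : 0 ≤ A'' := by
    have := hBn 0 3
    have := hBn 1 3
    have := hBn 1 4
    positivity
  have hdiff : ∀ lam ∈ Λ, |P.ACV est lam - P.CV cvest lam| ≤ A'' / (2 * n ^ 2) := by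
    intro lam hm
    refine (R.abs_ACV_sub_CV_le hB03 hB11 hB13 hB14 hcvest hm).trans_eq ?_
    simp only [A'', B, κ₂]
    field_simp
  have hpath : ∀ lam ∈ Λ, ∀ lam' ∈ Λ, lam' < lam →
      |‖est lam - est lam'‖ - 1 / n * (A / cobj)| ^ 2 ≤
        (A ^ 2 + 2 * cobj * A') / (n ^ 2 * cobj ^ 2) +
          2 * (P.ACV est lam - P.ACV est lam') / cobj := by
    intro lam hm lam' hm' hlt
    have h1 := R.empLoss_sub_ge hm hm' hlt
    have h2 := (abs_le.1 (R.abs_ACV_sub_le hB11 hB12 hm)).1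
    have h3 := (abs_le.1 (R.abs_ACV_sub_le hB11 hB12 hm')).2
    have h4 := R.avg_newtonQuad_sub_le hB11 hB02 hm hm' hlt
    have h5 := mul_le_mul_of_nonneg_left h4 (by positivity : 0 ≤ 1 / (n : ℝ))
    set Δ := ‖est lam - est lam'‖
    have e1 : (P.moment Λ est 1 2).toReal / (2 * n ^ 2 * cobj ^ 2) = A' / (2 * n ^ 2) := by
      simp only [A', B]; field_simp
    rw [e1] at h2 h3
    change _ ≤ 1 / (n : ℝ) * (A * Δ) at h5
    have key : cobj / 2 * Δ ^ 2 ≤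
        1 / n * (A * Δ) + A' / n ^ 2 + (P.ACV est lam - P.ACV est lam') := by
      have e2 : A' / (n : ℝ) ^ 2 = A' / (2 * n ^ 2) + A' / (2 * n ^ 2) := by field_simp; ring
      rw [e2]
      linarith
    have k2 := mul_le_mul_of_nonneg_left key (by positivity : 0 ≤ 2 / cobj)
    have e3 : 2 / cobj * (cobj / 2 * Δ ^ 2) = Δ ^ 2 := by field_simp
    -- Completing the square in `Δ`: the linear term `2 A Δ / (n c_m)` from `key` is twice `Δ` times
    -- the centre `A / (n c_m)`.
    have e4 : (A ^ 2 + 2 * cobj * A') / (n ^ 2 * cobj ^ 2) +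
        2 * (P.ACV est lam - P.ACV est lam') / cobj =
        2 / cobj * (1 / n * (A * Δ) + A' / n ^ 2 + (P.ACV est lam - P.ACV est lam')) -
          2 * Δ * (1 / n * (A / cobj)) + (1 / n * (A / cobj)) ^ 2 := by
      field_simp; ring
    rw [sq_abs, e4]
    nlinarith
  refine ⟨hpath, fun lamACV hmA lamCV hmC hminA hminC => ?_⟩
  have hsel : |‖est lamACV - est lamCV‖ - 1 / n * (A / cobj)| ^ 2 ≤
      (A ^ 2 + 2 * cobj * A' + 2 * cobj * A'') / (n ^ 2 * cobj ^ 2) := by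
    have e : (A ^ 2 + 2 * cobj * A' + 2 * cobj * A'') / (n ^ 2 * cobj ^ 2) =
        (A ^ 2 + 2 * cobj * A') / (n ^ 2 * cobj ^ 2) + 2 * (A'' / n ^ 2) / cobj := by
      field_simp
    have hq : 0 ≤ A'' / (n : ℝ) ^ 2 := by positivity
    have hAA : P.ACV est lamACV ≤ P.ACV est lamCV := hminA hmC
    rw [e]
    -- The path bound is applied with the larger level first. If that is `lamACV`, the ACV
    -- difference is nonpositive. If it is `lamCV`, optimality of `lamCV` for CV and two uses of
    -- `hdiff` bound the difference by `A'' / n²`.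
    rcases lt_trichotomy lamCV lamACV with hlt | rfl | hlt
    · refine (hpath _ hmA _ hmC hlt).trans ?_
      gcongr
      linarith
    · have e2 : |‖est lamCV - est lamCV‖ - 1 / n * (A / cobj)| ^ 2 =
          A ^ 2 / (n ^ 2 * cobj ^ 2) := by
        rw [sub_self, norm_zero, zero_sub, sq_abs]; field_simp
      rw [e2, add_div]
      have : 0 ≤ 2 * cobj * A' / (n ^ 2 * cobj ^ 2) := by positivity
      have : 0 ≤ 2 * (A'' / (n : ℝ) ^ 2) / cobj := by positivity
      linarith
    · rw [norm_sub_rev]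
      refine (hpath _ hmC _ hmA hlt).trans ?_
      have hCC : P.CV cvest lamCV ≤ P.CV cvest lamACV := hminC hmA
      have d1 := (abs_le.1 (hdiff _ hmC)).2
      have d2 := (abs_le.1 (hdiff _ hmA)).1
      have e2 : A'' / (n : ℝ) ^ 2 = A'' / (2 * n ^ 2) + A'' / (2 * n ^ 2) := by field_simp; ring
      gcongr
      linarith
  refine ⟨hsel, ?_⟩
  have hS : 0 ≤ A ^ 2 + 2 * cobj * A' + 2 * cobj * A'' := by positivity
  have h1 := Real.le_sqrt_of_sq_le hsel
  rw [Real.sqrt_div hS, ← mul_pow, Real.sqrt_sq (by positivity)] at h1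
  have h2 := (le_abs_self _).trans h1
  calc _ ≤ 1 / n * (A / cobj) + √(A ^ 2 + 2 * cobj * A' + 2 * cobj * A'') / (n * cobj) := by
        linarith
    _ = _ := by field_simp
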